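/- Let $n\ge 1$ and let $(M,g)$ be a smooth $n$-dimensional Riemannian manifold (without boundary, not necessarily complete) with Riemannian distance $d$. Let $\Omega\subset M$ be a domain (a nonempty, open and connected set) such that $\overline{\Omega}$ is compact, let $k\in\mathbb{R}$, and let $u\in C^0(\overline{\Omega})\cap C^2(\Omega)$ be a real-valued function satisfying $$ \begin{cases} \nabla^2 u=-\left(\dfrac1n+ku\right)g & \text{in } \Omega,\\ u>0 & \text{in } \Omega,\\ u=0 & \text{on } \partial\Omega, \end{cases} $$ where $\nabla^2u$ denotes the Riemannian Hessian of $u$. Then $\Omega$ is a metric ball and $u$ is a radial function. More precisely, $u$ attains its maximum over $\overline{\Omega}$ at a point of $\Omega$, and for every such maximum point $p\in\Omega$ there are a radius $\rho\in(0,\infty)$ with $\Omega=\{x\in M : d(p,x)<\rho\}$ and a function $f:\mathbb{R}\to\mathbb{R}$ with $u(x)=f(d(p,x))$ for all $x\in\overline{\Omega}$. -/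

import Mathlib

open Set Bundle VectorField
open scoped Manifold ContDiff

namespace RiemannianGeometry

noncomputable section

variable {E : Type*} [NormedAddCommGroup E] [NormedSpace ℝ E]
  {H : Type*} [TopologicalSpace H] (I : ModelWithCorners ℝ E H)
  {M : Type*} [TopologicalSpace M] [ChartedSpace H M]
  [RiemannianBundle (fun x : M ↦ TangentSpace I x)]

/-- The derivative at `x` of the function `⟨X, Y⟩` in the direction `v`. -/
def dInner (X Y : Π x : M, TangentSpace I x) (x : M) (v : TangentSpace I x) : ℝ :=
  mvfderiv I (fun y ↦ (inner ℝ (X y) (Y y) : ℝ)) x v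

/-- The right-hand side of the Koszul formula,
`X⟨Y, Z⟩ + Y⟨Z, X⟩ - Z⟨X, Y⟩ + ⟨[X, Y], Z⟩ - ⟨[X, Z], Y⟩ - ⟨[Y, Z], X⟩`,
which is `2 ⟨∇_X Y, Z⟩` for the Levi-Civita connection `∇`. -/
def koszul (X Y Z : Π x : M, TangentSpace I x) (x : M) : ℝ :=
  dInner I Y Z x (X x) + dInner I Z X x (Y x) - dInner I X Y x (Z x)
    + inner ℝ (mlieBracket I X Y x) (Z x)
    - inner ℝ (mlieBracket I X Z x) (Y x)
    - inner ℝ (mlieBracket I Y Z x) (X x)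

theorem dInner_comm (X Y : Π x : M, TangentSpace I x) (x : M) (v : TangentSpace I x) :
    dInner I X Y x v = dInner I Y X x v := by
  simp only [dInner, real_inner_comm]

theorem dInner_add (X Y : Π x : M, TangentSpace I x) (x : M) (v w : TangentSpace I x) :
    dInner I X Y x (v + w) = dInner I X Y x v + dInner I X Y x w :=
  map_add _ _ _

theorem dInner_smul (X Y : Π x : M, TangentSpace I x) (x : M) (c : ℝ) (v : TangentSpace I x) :
    dInner I X Y x (c • v) = c * dInner I X Y x v :=
  map_smul _ _ _

/-- Tangent vectors with the same inner products against vector fields are equal. -/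
theorem tangent_ext [IsManifold I ∞ M] {x : M} {a b : TangentSpace I x}
    (h : ∀ Z : Π x : M, TangentSpace I x, MDiffAt (T% Z) x →
      (inner ℝ a (Z x) : ℝ) = inner ℝ b (Z x)) : a = b := by
  refine ext_inner_right ℝ fun w ↦ ?_
  simpa using h (FiberBundle.extend E w) (FiberBundle.mdifferentiableAt_extend ..)

variable [IsManifold I ∞ M]
  [IsContMDiffRiemannianBundle I ∞ E (fun x : M ↦ TangentSpace I x)]
  {X X' Y Y' Z : Π x : M, TangentSpace I x} {x : M}

theorem mdifferentiableAt_inner (hX : MDiffAt (T% X) x) (hY : MDiffAt (T% Y) x) :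
    MDiffAt (fun y ↦ (inner ℝ (X y) (Y y) : ℝ)) x :=
  MDifferentiableAt.inner_bundle (F := E) (E := fun x : M ↦ TangentSpace I x) hX hY

theorem dInner_add_left (hX : MDiffAt (T% X) x) (hX' : MDiffAt (T% X') x)
    (hY : MDiffAt (T% Y) x) (v : TangentSpace I x) :
    dInner I (X + X') Y x v = dInner I X Y x v + dInner I X' Y x v := by
  have h := mvfderiv_fun_add (mdifferentiableAt_inner I hX hY) (mdifferentiableAt_inner I hX' hY)
  have h' := congrArg (fun L ↦ L v) h
  have e : (fun y ↦ (inner ℝ ((X + X') y) (Y y) : ℝ))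
      = fun y ↦ (inner ℝ (X y) (Y y) + inner ℝ (X' y) (Y y) : ℝ) := by
    funext y
    exact inner_add_left _ _ _
  rw [dInner, e]
  exact h'

theorem dInner_add_right (hX : MDiffAt (T% X) x) (hX' : MDiffAt (T% X') x)
    (hY : MDiffAt (T% Y) x) (v : TangentSpace I x) :
    dInner I Y (X + X') x v = dInner I Y X x v + dInner I Y X' x v := by
  simp only [dInner_comm I Y, dInner_add_left I hX hX' hY]

theorem dInner_smul_left {f : M → ℝ} (hf : MDiffAt f x) (hX : MDiffAt (T% X) x)
    (hY : MDiffAt (T% Y) x) (v : TangentSpace I x) :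
    dInner I (f • X) Y x v
      = f x * dInner I X Y x v + mvfderiv I f x v * inner ℝ (X x) (Y x) := by
  have h := mvfderiv_fun_mul hf (mdifferentiableAt_inner I hX hY)
  have h' := congrArg (fun L ↦ L v) h
  have e : (fun y ↦ (inner ℝ ((f • X) y) (Y y) : ℝ)) = fun y ↦ f y * inner ℝ (X y) (Y y) := by
    funext y
    exact real_inner_smul_left _ _ _
  rw [dInner, e, mul_comm (mvfderiv I f x v)]
  exact h'

theorem dInner_smul_right {f : M → ℝ} (hf : MDiffAt f x) (hX : MDiffAt (T% X) x)
    (hY : MDiffAt (T% Y) x) (v : TangentSpace I x) :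
    dInner I Y (f • X) x v
      = f x * dInner I Y X x v + mvfderiv I f x v * inner ℝ (X x) (Y x) := by
  simp only [dInner_comm I Y, dInner_smul_left I hf hX hY]

variable [CompleteSpace E]

theorem koszul_add_left (hX : MDiffAt (T% X) x) (hX' : MDiffAt (T% X') x)
    (hY : MDiffAt (T% Y) x) (hZ : MDiffAt (T% Z) x) :
    koszul I (X + X') Y Z x = koszul I X Y Z x + koszul I X' Y Z x := by
  simp only [koszul, dInner_add_left I hX hX' hY, dInner_add_right I hX hX' hZ, Pi.add_apply,
    dInner_add, mlieBracket_add_left hX hX', inner_add_right, inner_add_left]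
  ring

theorem koszul_smul_left {f : M → ℝ} (hf : MDiffAt f x) (hX : MDiffAt (T% X) x)
    (hY : MDiffAt (T% Y) x) (hZ : MDiffAt (T% Z) x) :
    koszul I (f • X) Y Z x = f x * koszul I X Y Z x := by
  simp only [koszul, dInner_smul_left I hf hX hY, dInner_smul_right I hf hX hZ,
    mlieBracket_smul_left hf hX, Pi.smul_apply', dInner_smul,
    inner_add_left, real_inner_smul_left, real_inner_smul_right]
  ring

theorem koszul_add_mid (hX : MDiffAt (T% X) x) (hY : MDiffAt (T% Y) x)
    (hY' : MDiffAt (T% Y') x) (hZ : MDiffAt (T% Z) x) :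
    koszul I X (Y + Y') Z x = koszul I X Y Z x + koszul I X Y' Z x := by
  simp only [koszul, dInner_add_left I hY hY' hZ, dInner_add_right I hY hY' hX, Pi.add_apply,
    dInner_add, mlieBracket_add_left hY hY', mlieBracket_add_right hY hY',
    inner_add_right, inner_add_left]
  ring

theorem koszul_smul_mid {f : M → ℝ} (hf : MDiffAt f x) (hX : MDiffAt (T% X) x)
    (hY : MDiffAt (T% Y) x) (hZ : MDiffAt (T% Z) x) :
    koszul I X (f • Y) Z x
      = f x * koszul I X Y Z x + 2 * (mvfderiv I f x (X x) * inner ℝ (Y x) (Z x)) := by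
  simp only [koszul, dInner_smul_left I hf hY hZ, dInner_smul_right I hf hY hX,
    mlieBracket_smul_left hf hY, mlieBracket_smul_right hf hY, Pi.smul_apply', dInner_smul,
    inner_add_left, real_inner_smul_left, real_inner_smul_right]
  ring

theorem koszul_add_right (hX : MDiffAt (T% X) x) (hY : MDiffAt (T% Y) x)
    (hZ : MDiffAt (T% Z) x) (hY' : MDiffAt (T% Y') x) :
    koszul I X Y (Z + Y') x = koszul I X Y Z x + koszul I X Y Y' x := by
  simp only [koszul, dInner_add_left I hZ hY' hX, dInner_add_right I hZ hY' hY, Pi.add_apply,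
    dInner_add, mlieBracket_add_right hZ hY', inner_add_right, inner_add_left]
  ring

theorem koszul_smul_right {f : M → ℝ} (hf : MDiffAt f x) (hX : MDiffAt (T% X) x)
    (hY : MDiffAt (T% Y) x) (hZ : MDiffAt (T% Z) x) :
    koszul I X Y (f • Z) x = f x * koszul I X Y Z x := by
  simp only [koszul, dInner_smul_left I hf hZ hX, dInner_smul_right I hf hZ hY,
    mlieBracket_smul_right hf hZ, Pi.smul_apply', dInner_smul,
    inner_add_left, real_inner_smul_left, real_inner_smul_right]
  ring

theorem koszul_tensorial_left (hY : MDiffAt (T% Y) x) (hZ : MDiffAt (T% Z) x) :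
    TensorialAt I E (fun X ↦ koszul I X Y Z x) x where
  smul hf hX := koszul_smul_left I hf hX hY hZ
  add hX hX' := koszul_add_left I hX hX' hY hZ

theorem koszul_tensorial_right (hX : MDiffAt (T% X) x) (hY : MDiffAt (T% Y) x) :
    TensorialAt I E (fun Z ↦ koszul I X Y Z x) x where
  smul hf hZ := koszul_smul_right I hf hX hY hZ
  add hZ hZ' := koszul_add_right I hX hY hZ hZ'

variable [FiniteDimensional ℝ E]

instance (x : M) : FiniteDimensional ℝ (TangentSpace I x) :=
  inferInstanceAs (FiniteDimensional ℝ E)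

instance (x : M) : CompleteSpace (TangentSpace I x) := FiniteDimensional.complete ℝ _

open Classical in
/-- The covariant derivative of the Levi-Civita connection, as a map on vector fields:
`leviCivitaFun I Y x v` is `∇_v Y`, defined by the Koszul formula when `Y` is differentiable at
`x` (and by the junk value `0` otherwise). -/
def leviCivitaFun (Y : Π x : M, TangentSpace I x) (x : M) :
    TangentSpace I x →L[ℝ] TangentSpace I x :=
  if hY : MDiffAt (T% Y) x then
    let B := TensorialAt.mkHom₂ (fun X Z ↦ koszul I X Y Z x) x
      (fun _ hZ ↦ koszul_tensorial_left I hY hZ) (fun _ hX ↦ koszul_tensorial_right I hX hY)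
    LinearMap.toContinuousLinearMap
      { toFun := fun v ↦ (1 / 2 : ℝ) • (InnerProductSpace.toDual ℝ (TangentSpace I x)).symm (B v)
        map_add' := fun v w ↦ by simp
        map_smul' := fun c v ↦ by simp [smul_comm c] }
  else 0

/-- The Koszul formula: `2 ⟨∇_X Y, Z⟩ = koszul X Y Z`. -/
theorem two_mul_inner_leviCivitaFun (hX : MDiffAt (T% X) x) (hY : MDiffAt (T% Y) x)
    (hZ : MDiffAt (T% Z) x) :
    2 * inner ℝ (leviCivitaFun I Y x (X x)) (Z x) = koszul I X Y Z x := by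
  rw [leviCivitaFun, dif_pos hY]
  simp only [LinearMap.coe_toContinuousLinearMap', LinearMap.coe_mk, AddHom.coe_mk,
    real_inner_smul_left, InnerProductSpace.toDual_symm_apply]
  rw [TensorialAt.mkHom₂_apply _ _ hX hZ]
  ring

theorem isCovariantDerivativeOn_leviCivitaFun :
    IsCovariantDerivativeOn E (leviCivitaFun I (M := M)) where
  add {Y Y' x} hY hY' _ := by
    ext v
    refine tangent_ext I fun Z hZ ↦ ?_
    obtain ⟨X, hX, rfl⟩ : ∃ X : Π x : M, TangentSpace I x, MDiffAt (T% X) x ∧ X x = v :=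
      ⟨FiberBundle.extend E v, FiberBundle.mdifferentiableAt_extend .., by simp⟩
    have h1 := two_mul_inner_leviCivitaFun I hX (mdifferentiableAt_add_section hY hY') hZ
    have h2 := two_mul_inner_leviCivitaFun I hX hY hZ
    have h3 := two_mul_inner_leviCivitaFun I hX hY' hZ
    rw [koszul_add_mid I hX hY hY' hZ] at h1
    simp only [_root_.add_apply, inner_add_left]
    linarith
  leibniz {Y f x} hY hf _ := by
    ext v
    refine tangent_ext I fun Z hZ ↦ ?_
    obtain ⟨X, hX, rfl⟩ : ∃ X : Π x : M, TangentSpace I x, MDiffAt (T% X) x ∧ X x = v :=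
      ⟨FiberBundle.extend E v, FiberBundle.mdifferentiableAt_extend .., by simp⟩
    have h1 := two_mul_inner_leviCivitaFun I hX (hf.smul_section hY) hZ
    have h2 := two_mul_inner_leviCivitaFun I hX hY hZ
    rw [koszul_smul_mid I hf hX hY hZ] at h1
    simp only [_root_.add_apply, _root_.smul_apply,
      ContinuousLinearMap.smulRight_apply, inner_add_left, real_inner_smul_left]
    rw [← h2] at h1
    linarith

variable (M) in
/-- The Levi-Civita connection of a Riemannian manifold. -/
def leviCivita : CovariantDerivative I E (TangentSpace I : M → Type _) where
  toFun := leviCivitaFun I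
  isCovariantDerivativeOnUniv := isCovariantDerivativeOn_leviCivitaFun I

/-- The Levi-Civita connection is torsion-free. -/
theorem torsion_leviCivita : (leviCivita I M).torsion = 0 := by
  rw [CovariantDerivative.torsion_eq_zero_iff]
  intro X Y x hX hY
  refine tangent_ext I fun Z hZ ↦ ?_
  have h1 := two_mul_inner_leviCivitaFun I hX hY hZ
  have h2 := two_mul_inner_leviCivitaFun I hY hX hZ
  change inner ℝ (leviCivitaFun I Y x (X x) - leviCivitaFun I X x (Y x)) (Z x) = _
  rw [inner_sub_left]
  simp only [koszul, mlieBracket_swap_apply (V := Y) (W := X), inner_neg_left,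
    dInner_comm I Y X, dInner_comm I Z] at h1 h2
  linarith

/-- The Levi-Civita connection is compatible with the metric:
`X⟨Y, Z⟩ = ⟨∇_X Y, Z⟩ + ⟨Y, ∇_X Z⟩`. -/
theorem mvfderiv_inner_leviCivita (hX : MDiffAt (T% X) x) (hY : MDiffAt (T% Y) x)
    (hZ : MDiffAt (T% Z) x) :
    mvfderiv I (fun y ↦ (inner ℝ (Y y) (Z y) : ℝ)) x (X x)
      = inner ℝ (leviCivita I M Y x (X x)) (Z x) + inner ℝ (Y x) (leviCivita I M Z x (X x)) := by
  have h1 := two_mul_inner_leviCivitaFun I hX hY hZ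
  have h2 := two_mul_inner_leviCivitaFun I hX hZ hY
  change dInner I Y Z x (X x) = inner ℝ (leviCivitaFun I Y x (X x)) (Z x)
    + inner ℝ (Y x) (leviCivitaFun I Z x (X x))
  rw [real_inner_comm _ (Y x)]
  simp only [koszul, mlieBracket_swap_apply (V := Z) (W := Y), inner_neg_left,
    dInner_comm I Z, dInner_comm I Y X] at h1 h2
  linarith

/-- The gradient of `u`: `⟨∇u, v⟩ = du(v)`. -/
def gradient (u : M → ℝ) (x : M) : TangentSpace I x :=
  (InnerProductSpace.toDual ℝ (TangentSpace I x)).symm (mvfderiv I u x)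

/-- The Hessian of `u`: `∇²u(v, w) = ⟨∇_v ∇u, w⟩`. -/
def hessian (u : M → ℝ) (x : M) (v w : TangentSpace I x) : ℝ :=
  inner ℝ (leviCivita I M (gradient I u) x v) w

end

end RiemannianGeometry

namespace RiemannianGeometry

open Filter Topology

/-! ### Differentiability of the gradient, and the Hessian as a derivative. -/

section

variable {E : Type*} [NormedAddCommGroup E] [NormedSpace ℝ E]
  {H : Type*} [TopologicalSpace H] {I : ModelWithCorners ℝ E H}
  {M : Type*} [TopologicalSpace M] [ChartedSpace H M]

/-! Write `a = 1/n` and `m = u p` for the maximum. The equation makes `|∇u|² + 2au + ku²` constant,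
and evaluating it at `p` gives `|∇u|² = (m - u)(2a + k(u + m))`. Thus the length of the gradient
depends only on the value of `u`. Near `p` this forces `a + km ≥ 0`, since otherwise `u` would be
locally constant with a nonzero Hessian.

If `a + km = 0`, the identity reads `|∇u| = √(-k) |u - m|`, and Grönwall makes `u` constant. The
boundary is then empty and `Ω` is a compact connected component of `M`, which is a ball of large
radius.

If `a + km > 0`, let `f` be the decreasing function with `f(m) = 0` and `f'(s) = -1/√((m - s)(2a +
k(s + m)))`, so that `φ = f ∘ u` has gradient of norm one where `u < m`. Then `φ(x) = d(p, x)`. For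
the lower bound, `φ` grows at most as fast as length along paths in `Ω`, and a path leaving `Ω` has
length at least `f(0)` (`ofReal_profile_le_edist`). For the upper bound, a variational argument on a
compact superlevel set finds a maximum point within distance `φ(x)` of `x`
(`edist_le_ofReal_profile`). That point is `p`: maxima are nondegenerate, hence isolated, all other
points are regular, and a mountain pass argument excludes a second maximum (`eq_of_isolated_max`).
Hence `Ω` is the ball of radius `f(0)`, and `u` is the inverse of `f` applied to the distance. No
geodesics, gradient flow or completeness enter. -/

theorem mdifferentiableAt_pi {ι : Type*} [Fintype ι] {f : M → ι → ℝ} {x : M}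
    (hf : ∀ i, MDiffAt (fun y ↦ f y i) x) : MDifferentiableAt I 𝓘(ℝ, ι → ℝ) f x := by
  simp only [mdifferentiableAt_iff, writtenInExtChartAt, extChartAt_model_space_eq_id] at hf ⊢
  exact ⟨continuousAt_pi.2 fun i ↦ (hf i).1, differentiableWithinAt_pi.2 fun i ↦ (hf i).2⟩

theorem mdifferentiableAt_fun_sum {ι F : Type*} [Fintype ι] [NormedAddCommGroup F] [NormedSpace ℝ F]
    {f : ι → M → F} {x : M}
    (hf : ∀ i, MDiffAt (f i) x) : MDiffAt (fun y ↦ ∑ i, f i y) x := by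
  simp only [mdifferentiableAt_iff, writtenInExtChartAt, extChartAt_model_space_eq_id] at hf ⊢
  exact ⟨tendsto_finsetSum _ fun i _ ↦ (hf i).1,
    DifferentiableWithinAt.fun_sum fun i _ ↦ (hf i).2⟩

theorem mdifferentiableAt_real_comp {u : M → ℝ} {x : M} {q : ℝ → ℝ} {q' : ℝ}
    (hq : HasDerivAt q q' (u x)) (hu : MDiffAt u x) : MDiffAt (fun y ↦ q (u y)) x :=
  hq.differentiableAt.comp_mdifferentiableAt hu

theorem mvfderiv_real_comp {u : M → ℝ} {x : M} {q : ℝ → ℝ} {q' : ℝ}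
    (hq : HasDerivAt q q' (u x)) (hu : MDiffAt u x) (v : TangentSpace I x) :
    mvfderiv I (fun y ↦ q (u y)) x v = q' * mvfderiv I u x v := by
  have h := mvfderiv_comp_apply (I := 𝓘(ℝ)) (I' := I) (f := u) (g := q) x
    hq.differentiableAt.mdifferentiableAt hu v
  refine h.trans ?_
  have h2 : mvfderiv 𝓘(ℝ) q (u x) = fderiv ℝ q (u x) := by
    simp only [mvfderiv, mfderiv_eq_fderiv]
    rfl
  rw [h2, hq.hasFDerivAt.fderiv]
  rw [mul_comm]
  rfl

section

variable [FiniteDimensional ℝ E] [RiemannianBundle (fun x : M ↦ TangentSpace I x)]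

theorem inner_gradient (u : M → ℝ) (x : M) (v : TangentSpace I x) :
    inner ℝ (gradient I u x) v = mvfderiv I u x v := by
  simp [gradient, InnerProductSpace.toDual_symm_apply]

end

variable [IsManifold I ∞ M]

theorem mdifferentiableAt_mvfderiv_apply {u : M → ℝ} {x : M} (hu : ContMDiffAt I 𝓘(ℝ) 2 u x)
    {Z : Π x : M, TangentSpace I x} (hZ : MDiffAt (T% Z) x) :
    MDiffAt (fun y ↦ mvfderiv I u y (Z y)) x := by
  have h1 := (hu.mfderiv_const (m := 1) (by norm_num)).mdifferentiableAt one_ne_zero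
  have h2 := MDifferentiableAt.clm_apply_of_inCoordinates (b₁ := id) (b₂ := u) h1 hZ
    (hu.mdifferentiableAt two_ne_zero)
  rw [mdifferentiableAt_totalSpace] at h2
  refine h2.2.congr_of_eventuallyEq ?_
  filter_upwards with y
  simp [mvfderiv]
  rfl

variable [RiemannianBundle (fun x : M ↦ TangentSpace I x)]
  [IsContMDiffRiemannianBundle I ∞ E (fun x : M ↦ TangentSpace I x)] [FiniteDimensional ℝ E]

/-- A vector field is differentiable as soon as its inner products with differentiable vector
fields are. -/
theorem mdifferentiableAt_of_inner {X : Π x : M, TangentSpace I x} {x : M}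
    (hX : ∀ Z : Π x : M, TangentSpace I x, MDiffAt (T% Z) x →
      MDiffAt (fun y ↦ (inner ℝ (Z y) (X y) : ℝ)) x) : MDiffAt (T% X) x := by
  classical
  set e := trivializationAt E (TangentSpace I : M → Type _) x
  have hx : x ∈ e.baseSet := FiberBundle.mem_baseSet_trivializationAt ..
  obtain ⟨ι, _, ⟨b⟩⟩ : ∃ (ι : Type) (_ : Fintype ι), Nonempty (Module.Basis ι ℝ E) :=
    ⟨Fin (Module.finrank ℝ E), inferInstance, ⟨Module.finBasis ℝ E⟩⟩
  let s := e.localFrame b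
  have hs (i) : MDiffAt (T% (s i)) x :=
    (contMDiffAt_localFrame_of_mem 1 _ b i hx).mdifferentiableAt (by simp)
  let c : M → ι → ℝ := fun y i ↦ e.localFrameCoeff I b i y (X y)
  let β : M → ι → ℝ := fun y i ↦ inner ℝ (s i y) (X y)
  -- The Gram matrix of the local frame. It sends the coefficients `c` of `X` to the inner products
  -- `β`, which are differentiable by hypothesis; so `c = T⁻¹ β` is differentiable once `T x` is
  -- invertible.
  let T : M → (ι → ℝ) →L[ℝ] (ι → ℝ) := fun y ↦
    ∑ i, ∑ j, (inner ℝ (s i y) (s j y) : ℝ) •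
      (ContinuousLinearMap.proj (R := ℝ) (φ := fun _ : ι ↦ ℝ) j).smulRight
        (Pi.single (M := fun _ : ι ↦ ℝ) i (1 : ℝ))
  have hT (y) (w : ι → ℝ) (i : ι) :
      T y w i = inner ℝ (s i y) (∑ j, w j • s j y) := by
    simp [T, inner_sum, real_inner_smul_right, Finset.sum_apply, Pi.single_apply, mul_comm]
  have hTc : ∀ᶠ y in 𝓝 x, T y (c y) = β y := by
    filter_upwards [e.open_baseSet.mem_nhds hx] with y hy
    ext i
    rw [hT]
    exact congrArg (inner ℝ (s i y)) (e.eq_sum_localFrameCoeff_smul (I := I) (s := X) hy).symm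
  have hTinj : Function.Injective (T x) := by
    rw [injective_iff_map_eq_zero]
    intro w hw
    have h0 : (∑ j, w j • s j x) = 0 := by
      rw [← inner_self_eq_zero (𝕜 := ℝ)]
      conv_lhs => rw [sum_inner]
      refine Finset.sum_eq_zero fun i _ ↦ ?_
      rw [real_inner_smul_left, ← hT x w i, hw]
      simp
    have hli : LinearIndependent ℝ (fun j ↦ s j x) :=
      (e.isLocalFrameOn_localFrame_baseSet I 1 b).linearIndependent hx
    ext j
    exact Fintype.linearIndependent_iff.1 hli w h0 j
  let Te : (ι → ℝ) ≃L[ℝ] (ι → ℝ) :=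
    (LinearEquiv.ofInjectiveEndo (T x : (ι → ℝ) →ₗ[ℝ] (ι → ℝ)) hTinj).toContinuousLinearEquiv
  have hTe : (Te : (ι → ℝ) →L[ℝ] (ι → ℝ)) = T x := by ext; rfl
  have hTd : MDiffAt T x := 
    mdifferentiableAt_fun_sum fun i ↦ mdifferentiableAt_fun_sum fun j ↦
      (mdifferentiableAt_inner I (hs i) (hs j)).smul mdifferentiableAt_const
  have hβ : MDifferentiableAt I 𝓘(ℝ, ι → ℝ) β x := mdifferentiableAt_pi fun i ↦ hX _ (hs i)
  have hc : MDifferentiableAt I 𝓘(ℝ, ι → ℝ) c x := by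
    have h1 : MDiffAt (fun y ↦ (T y).inverse) x := by
      refine DifferentiableAt.comp_mdifferentiableAt (g := ContinuousLinearMap.inverse) ?_ hTd
      rw [← hTe]
      exact (contDiffAt_map_inverse (n := 1) Te).differentiableAt one_ne_zero
    refine (h1.clm_apply hβ).congr_of_eventuallyEq ?_
    have hunit : ∀ᶠ y in 𝓝 x, T y ∈ range ((↑) : ((ι → ℝ) ≃L[ℝ] (ι → ℝ)) → _) :=
      hTd.continuousAt.eventually_mem (hTe ▸ Te.nhds)
    filter_upwards [hTc, hunit] with y hy ⟨S, hS⟩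
    rw [← hy, ← hS]
    simp
  refine (mdifferentiableAt_iff_localFrameCoeff b hx).2 fun i ↦ ?_
  exact (ContinuousLinearMap.proj (R := ℝ) (φ := fun _ : ι ↦ ℝ) i).differentiableAt
    |>.comp_mdifferentiableAt hc

theorem mdifferentiableAt_gradient {u : M → ℝ} {x : M} (hu : ContMDiffAt I 𝓘(ℝ) 2 u x) :
    MDiffAt (T% (gradient I u)) x := by
  refine mdifferentiableAt_of_inner fun Z hZ ↦ ?_
  simpa only [real_inner_comm (gradient I u _), inner_gradient] using mdifferentiableAt_mvfderiv_apply hu hZ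

/-- The quantity `|∇u|² + 2 a u + k u²` is constant along solutions of `∇²u = -(a + k u) g`. -/
theorem mvfderiv_first_integral {u : M → ℝ} {x : M} (hu : ContMDiffAt I 𝓘(ℝ) 2 u x) {a k : ℝ}
    (hh : ∀ v w : TangentSpace I x, hessian I u x v w = -(a + k * u x) * inner ℝ v w) :
    MDiffAt (fun y ↦ (inner ℝ (gradient I u y) (gradient I u y)
      + (2 * a * u y + k * u y ^ 2) : ℝ)) x ∧
    mvfderiv I (fun y ↦ (inner ℝ (gradient I u y) (gradient I u y)
      + (2 * a * u y + k * u y ^ 2) : ℝ)) x = 0 := by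
  have hG := mdifferentiableAt_gradient hu
  have hd := hu.mdifferentiableAt two_ne_zero
  have h1 := mdifferentiableAt_inner I hG hG
  let q : ℝ → ℝ := fun s ↦ 2 * a * s + k * s ^ 2
  have hq (s : ℝ) : HasDerivAt q (2 * a + 2 * k * s) s := by
    have := ((hasDerivAt_id s).const_mul (2 * a)).add (((hasDerivAt_id s).pow 2).const_mul k)
    refine this.congr_deriv ?_
    simp
    ring
  have h2 : MDiffAt (fun y ↦ q (u y)) x := mdifferentiableAt_real_comp (hq (u x)) hd
  refine ⟨h1.add h2, ?_⟩
  ext v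
  have e1 := mvfderiv_inner_leviCivita I (x := x) (X := FiberBundle.extend E v)
    (FiberBundle.mdifferentiableAt_extend ..) hG hG
  rw [FiberBundle.extend_apply_self] at e1
  have e2 := mvfderiv_real_comp (hq (u x)) hd v
  have e3 := mvfderiv_fun_add h1 h2
  have e4 := congrArg (fun L ↦ L v) e3
  refine e4.trans ?_
  rw [_root_.add_apply, e1, e2, ← inner_gradient]
  -- Testing the Hessian against `∇u` gives `d|∇u|²(v) = -2(a + ku) du(v)`, which cancels the
  -- derivative of `2au + ku²`.
  have h3 := hh v (gradient I u x)
  rw [hessian] at h3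
  rw [real_inner_comm _ (gradient I u x), h3, real_inner_comm v]
  simp
  ring

/-- At a critical point of `u`, the derivative of `du(Z)` is given by the Hessian of `u`. -/
theorem mvfderiv_mvfderiv_apply {u : M → ℝ} {x : M} (hu : ContMDiffAt I 𝓘(ℝ) 2 u x)
    (hx : mvfderiv I u x = 0) {Z : Π x : M, TangentSpace I x} (hZ : MDiffAt (T% Z) x)
    (v : TangentSpace I x) :
    mvfderiv I (fun y ↦ mvfderiv I u y (Z y)) x v = hessian I u x v (Z x) := by
  have e1 := mvfderiv_inner_leviCivita I (x := x) (X := FiberBundle.extend E v)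
    (FiberBundle.mdifferentiableAt_extend ..) (mdifferentiableAt_gradient hu) hZ
  -- The remaining term of the product rule is `du(∇_v Z)`, which vanishes at a critical point.
  rw [FiberBundle.extend_apply_self, inner_gradient, hx] at e1
  simpa [inner_gradient, hessian] using e1

end

/-! ### Calculus in charts: straight lines, their length, and Grönwall. -/

section

variable {E : Type*} [NormedAddCommGroup E] [NormedSpace ℝ E]
  {M : Type*} [TopologicalSpace M] [ChartedSpace E M] [IsManifold 𝓘(ℝ, E) ∞ M]

/-- The tangent bundle is trivialized by the derivatives of charts. Expressing the derivative of the
inverse chart through `symmL` gives access to the norm estimates for trivializations of a Riemannian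
bundle. -/
theorem hasMFDerivAt_extChartAt_symm (x : M) {z : E} (hz : z ∈ (extChartAt 𝓘(ℝ, E) x).target) :
    HasMFDerivAt 𝓘(ℝ, E) 𝓘(ℝ, E) (extChartAt 𝓘(ℝ, E) x).symm z
      ((trivializationAt E (TangentSpace 𝓘(ℝ, E)) x).symmL ℝ ((extChartAt 𝓘(ℝ, E) x).symm z)) := by
  have h1 : (extChartAt 𝓘(ℝ, E) x).symm z ∈ (chartAt E x).source := by
    simpa using (extChartAt 𝓘(ℝ, E) x).map_target hz
  rw [TangentBundle.symmL_trivializationAt h1, (extChartAt 𝓘(ℝ, E) x).right_inv hz]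
  have := (mdifferentiableWithinAt_extChartAt_symm hz).hasMFDerivWithinAt
  simpa using! this

theorem hasFDerivAt_comp_extChartAt_symm (x : M) {z : E} (hz : z ∈ (extChartAt 𝓘(ℝ, E) x).target)
    {u : M → ℝ} (hu : MDiffAt u ((extChartAt 𝓘(ℝ, E) x).symm z)) :
    HasFDerivAt (fun w ↦ u ((extChartAt 𝓘(ℝ, E) x).symm w))
      ((mvfderiv 𝓘(ℝ, E) u ((extChartAt 𝓘(ℝ, E) x).symm z)).comp
        ((trivializationAt E (TangentSpace 𝓘(ℝ, E)) x).symmL ℝ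
          ((extChartAt 𝓘(ℝ, E) x).symm z))) z := by
  have := hu.hasMFDerivAt.comp z (hasMFDerivAt_extChartAt_symm x hz)
  exact this.hasFDerivAt

/-- The straight line in the chart at `x` issued from `x` in the direction of `v`. -/
noncomputable def chartLine (x : M) (v : TangentSpace 𝓘(ℝ, E) x) (t : ℝ) : M :=
  (extChartAt 𝓘(ℝ, E) x).symm (extChartAt 𝓘(ℝ, E) x x +
    t • (trivializationAt E (TangentSpace 𝓘(ℝ, E)) x).continuousLinearMapAt ℝ x v)

theorem hasDerivAt_comp_chartLine (x : M) (v : TangentSpace 𝓘(ℝ, E) x) {u : M → ℝ}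
    (hu : MDiffAt u x) :
    HasDerivAt (fun t ↦ u (chartLine x v t)) (mvfderiv 𝓘(ℝ, E) u x v) 0 := by
  have h0 : (extChartAt 𝓘(ℝ, E) x).symm (extChartAt 𝓘(ℝ, E) x x) = x := extChartAt_to_inv x
  have h1 := hasFDerivAt_comp_extChartAt_symm x (mem_extChartAt_target (I := 𝓘(ℝ, E)) x)
    (u := u) (by rwa [h0])
  set w := (trivializationAt E (TangentSpace 𝓘(ℝ, E)) x).continuousLinearMapAt ℝ x v with hw
  have h2 : HasDerivAt (fun t : ℝ ↦ extChartAt 𝓘(ℝ, E) x x + t • w) w 0 := by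
    simpa using ((hasDerivAt_id (0 : ℝ)).smul_const w).const_add (extChartAt 𝓘(ℝ, E) x x)
  have h3 := HasFDerivAt.comp_hasDerivAt_of_eq (0 : ℝ) h1 h2 (by simp)
  refine h3.congr_deriv ?_
  rw [ContinuousLinearMap.comp_apply, h0]
  congr 1
  exact Trivialization.symmL_continuousLinearMapAt _ (FiberBundle.mem_baseSet_trivializationAt ..) v

theorem continuousAt_chartLine (x : M) (v : TangentSpace 𝓘(ℝ, E) x) :
    ContinuousAt (chartLine x v) 0 := by
  refine ContinuousAt.comp (g := (extChartAt 𝓘(ℝ, E) x).symm) ?_ (by fun_prop)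
  simpa using continuousAt_extChartAt_symm (I := 𝓘(ℝ, E)) x

theorem chartLine_zero (x : M) (v : TangentSpace 𝓘(ℝ, E) x) : chartLine x v 0 = x := by
  simp [chartLine]

variable [RiemannianBundle (fun x : M ↦ TangentSpace 𝓘(ℝ, E) x)]
  [IsContMDiffRiemannianBundle 𝓘(ℝ, E) ∞ E (fun x : M ↦ TangentSpace 𝓘(ℝ, E) x)]

variable (E M) in
theorem isContinuousRiemannianBundle_tangentSpace :
    IsContinuousRiemannianBundle E (fun x : M ↦ TangentSpace 𝓘(ℝ, E) x) := by
  obtain ⟨g, hg, hg'⟩ := IsContMDiffRiemannianBundle.exists_contMDiff (IB := 𝓘(ℝ, E)) (n := ∞)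
    (F := E) (E := fun x : M ↦ TangentSpace 𝓘(ℝ, E) x)
  exact ⟨g, hg.continuous, hg'⟩

/-- The velocity at time `s` is the image of `v` under a map between tangent spaces that is the
identity at `x`. By continuity of the metric its operator norm stays below any `r > 1` near `x`,
which bounds the length of the line. -/
theorem eventually_riemannianEDist_chartLine_le (x : M) (v : TangentSpace 𝓘(ℝ, E) x) {r : ℝ}
    (hr : 1 < r) :
    ∀ᶠ t : ℝ in 𝓝[>] 0, Manifold.riemannianEDist 𝓘(ℝ, E) x (chartLine x v t)
      ≤ ENNReal.ofReal (t * (r * ‖v‖)) := by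
  set e := trivializationAt E (TangentSpace 𝓘(ℝ, E) : M → Type _) x with he
  have := isContinuousRiemannianBundle_tangentSpace E M
  have h1 := eventually_norm_symmL_trivializationAt_comp_self_lt E
    (fun x : M ↦ TangentSpace 𝓘(ℝ, E) x) x hr
  have h2 : ∀ᶠ t : ℝ in 𝓝 0, ‖(e.symmL ℝ (chartLine x v t)) ∘L (e.continuousLinearMapAt ℝ x)‖ < r :=
    (continuousAt_chartLine x v).eventually (by rwa [chartLine_zero])
  have h3 : ∀ᶠ t : ℝ in 𝓝 0, extChartAt 𝓘(ℝ, E) x x + t • e.continuousLinearMapAt ℝ x v ∈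
      (extChartAt 𝓘(ℝ, E) x).target := by
    have hc : ContinuousAt (fun t : ℝ ↦ extChartAt 𝓘(ℝ, E) x x
      + t • e.continuousLinearMapAt ℝ x v) 0 := by fun_prop
    refine hc.eventually_mem ?_
    simpa using extChartAt_target_mem_nhds (I := 𝓘(ℝ, E)) x
  obtain ⟨δ, hδ, hball⟩ := Metric.eventually_nhds_iff.1 (h2.and h3)
  filter_upwards [Ioo_mem_nhdsGT hδ] with t ht
  have hmem (s : ℝ) (hs : s ∈ Icc 0 t) := hball (y := s) (by
    rw [Real.dist_eq, sub_zero, abs_of_nonneg hs.1]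
    exact hs.2.trans_lt ht.2)
  have hsm : ContMDiffOn 𝓘(ℝ) 𝓘(ℝ, E) 1 (chartLine x v) (Icc 0 t) := by
    refine (contMDiffOn_extChartAt_symm (n := 1) x).comp (t := (extChartAt 𝓘(ℝ, E) x).target)
      (f := fun s : ℝ ↦ extChartAt 𝓘(ℝ, E) x x + s • e.continuousLinearMapAt ℝ x v) ?_
      fun s hs ↦ (hmem s hs).2
    rw [contMDiffOn_iff_contDiffOn]
    fun_prop
  refine (Manifold.riemannianEDist_le_pathELength hsm (chartLine_zero x v) rfl ht.1.le).trans ?_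
  rw [Manifold.pathELength_eq_lintegral_mfderiv_Icc]
  have hle : ∀ s ∈ Icc 0 t, ‖mfderiv 𝓘(ℝ) 𝓘(ℝ, E) (chartLine x v) s 1‖ₑ
      ≤ ENNReal.ofReal (r * ‖v‖) := by
    intro s hs
    obtain ⟨hn, htar⟩ := hmem s hs
    have hd : HasDerivAt (fun s : ℝ ↦ extChartAt 𝓘(ℝ, E) x x + s • e.continuousLinearMapAt ℝ x v)
        (e.continuousLinearMapAt ℝ x v) s := by
      simpa using ((hasDerivAt_id s).smul_const (e.continuousLinearMapAt ℝ x v)).const_add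
        (extChartAt 𝓘(ℝ, E) x x)
    have hm := (hasMFDerivAt_extChartAt_symm x htar).comp s hd.hasFDerivAt.hasMFDerivAt
    have hm' : mfderiv 𝓘(ℝ) 𝓘(ℝ, E) (chartLine x v) s 1
        = ((e.symmL ℝ (chartLine x v s)) ∘L (e.continuousLinearMapAt ℝ x)) v := by
      rw [show mfderiv 𝓘(ℝ) 𝓘(ℝ, E) (chartLine x v) s = _ from hm.mfderiv]
      exact congrArg (e.symmL ℝ (chartLine x v s)) (one_smul ℝ (e.continuousLinearMapAt ℝ x v))
    rw [hm', ← ofReal_norm]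
    refine ENNReal.ofReal_le_ofReal ((ContinuousLinearMap.le_opNorm _ v).trans ?_)
    gcongr
  refine (MeasureTheory.setLIntegral_mono' measurableSet_Icc hle).trans_eq ?_
  rw [MeasureTheory.setLIntegral_const, Real.volume_Icc, sub_zero, mul_comm,
    ENNReal.ofReal_mul ht.1.le]

/-- If `g` decreases at a rate larger than `c` in some direction at `x`, there are points `y`
arbitrarily close to `x` with `g y + c d(x, y) < g x`. -/
theorem exists_add_mul_riemannianEDist_lt {g : M → ℝ} {x : M} (hg : MDiffAt g x)
    {v : TangentSpace 𝓘(ℝ, E) x} {c : ℝ}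
    (hv : mvfderiv 𝓘(ℝ, E) g x v < -(c * ‖v‖)) {s : Set M} (hs : s ∈ 𝓝 x) :
    ∃ y ∈ s, ∃ δ : ℝ, 0 ≤ δ ∧ Manifold.riemannianEDist 𝓘(ℝ, E) x y ≤ ENNReal.ofReal δ ∧
      g y + c * δ < g x := by
  -- The strict inequality leaves room for the factor `r > 1` lost in the length of the chart line.
  obtain ⟨r, hr, hr'⟩ : ∃ r, 1 < r ∧ mvfderiv 𝓘(ℝ, E) g x v < -(c * (r * ‖v‖)) := by
    have hcont : Continuous (fun r : ℝ ↦ -(c * (r * ‖v‖))) := by fun_prop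
    have h1 : ∀ᶠ r : ℝ in 𝓝[>] 1, mvfderiv 𝓘(ℝ, E) g x v < -(c * (r * ‖v‖)) :=
      hcont.continuousWithinAt.eventually_const_lt (by simpa using hv)
    exact ((eventually_mem_nhdsWithin).and h1).exists
  have h2 := (hasDerivAt_comp_chartLine x v hg).tendsto_slope_zero_right.eventually_lt_const hr'
  have h3 : ∀ᶠ t : ℝ in 𝓝[>] 0, chartLine x v t ∈ s :=
    ((continuousAt_chartLine x v).mono_left nhdsWithin_le_nhds).eventually_mem
      (by rwa [chartLine_zero])
  obtain ⟨t, ⟨h2, h3, h4⟩, ht⟩ := ((h2.and (h3.and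
    (eventually_riemannianEDist_chartLine_le x v hr))).and eventually_mem_nhdsWithin).exists
  have ht : 0 < t := ht
  refine ⟨_, h3, t * (r * ‖v‖), by positivity, h4, ?_⟩
  rw [zero_add, chartLine_zero, smul_eq_mul, inv_mul_lt_iff₀ ht] at h2
  linarith

/-- Grönwall's inequality along the segments from `x` in a chart, where the tangent norm is at most
a constant times the model norm. -/
theorem eventually_eq_zero_of_abs_mvfderiv_le {w : M → ℝ} {s : Set M} {x : M} (hs : s ∈ 𝓝 x)
    (hw : ∀ x ∈ s, MDiffAt w x) {C : ℝ}
    (hC : ∀ x ∈ s, ∀ v : TangentSpace 𝓘(ℝ, E) x, |mvfderiv 𝓘(ℝ, E) w x v| ≤ C * ‖v‖ * |w x|)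
    (hwx : w x = 0) : ∀ᶠ y in 𝓝 x, y ∈ s ∧ w y = 0 := by
  set e := trivializationAt E (TangentSpace 𝓘(ℝ, E) : M → Type _) x with he
  set ψ := extChartAt 𝓘(ℝ, E) x with hψ
  have := isContinuousRiemannianBundle_tangentSpace E M
  obtain ⟨C₁, hC₁, h1⟩ := eventually_norm_symmL_trivializationAt_lt E
    (fun x : M ↦ TangentSpace 𝓘(ℝ, E) x) x
  have hψx : ψ.symm (ψ x) = x := extChartAt_to_inv x
  have hcont : ContinuousAt ψ.symm (ψ x) := continuousAt_extChartAt_symm x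
  have h2 : ∀ᶠ z in 𝓝 (ψ x), (‖e.symmL ℝ (ψ.symm z)‖ < C₁ ∧ ψ.symm z ∈ s) ∧ z ∈ ψ.target :=
    (hcont.eventually (by rw [hψx]; exact h1.and hs)).and (extChartAt_target_mem_nhds x)
  obtain ⟨r, hr, hball⟩ := Metric.eventually_nhds_iff_ball.1 h2
  have h3 : ∀ᶠ y in 𝓝 x, ψ y ∈ Metric.ball (ψ x) r :=
    (continuousAt_extChartAt x).eventually_mem (Metric.ball_mem_nhds _ hr)
  filter_upwards [h3, extChartAt_source_mem_nhds (I := 𝓘(ℝ, E)) x, hs] with y hy hys hy'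
  refine ⟨hy', ?_⟩
  let ℓ : ℝ → E := fun t ↦ ψ x + t • (ψ y - ψ x)
  have hℓ (t : ℝ) : HasDerivAt ℓ (ψ y - ψ x) t := by
    simpa [ℓ] using ((hasDerivAt_id t).smul_const (ψ y - ψ x)).const_add (ψ x)
  have hmem (t : ℝ) (ht : t ∈ Icc (0 : ℝ) 1) : ℓ t ∈ Metric.ball (ψ x) r :=
    (convex_ball (ψ x) r).add_smul_sub_mem (Metric.mem_ball_self hr) hy ht
  have hd (t : ℝ) (ht : t ∈ Icc (0 : ℝ) 1) :=
    (hasFDerivAt_comp_extChartAt_symm x (hball _ (hmem t ht)).2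
      (hw _ (hball _ (hmem t ht)).1.2)).comp_hasDerivAt t (hℓ t)
  have key := eq_zero_of_abs_deriv_le_mul_abs_self_of_eq_zero_right (K := |C| * (C₁ * ‖ψ y - ψ x‖))
    (f := fun t ↦ w (ψ.symm (ℓ t)))
    (fun t ht ↦ (hd t ht).continuousAt.continuousWithinAt)
    (fun t ht ↦ (hd t (Ico_subset_Icc_self ht)).hasDerivWithinAt) (by simp [ℓ, hψx, hwx]) ?_ 1
    (by simp)
  · simpa [ℓ, ψ.left_inv hys] using key
  · intro t ht
    have ht' := Ico_subset_Icc_self ht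
    refine (hC _ (hball _ (hmem t ht')).1.2 _).trans ?_
    gcongr
    · exact le_abs_self C
    · refine (ContinuousLinearMap.le_opNorm _ _).trans ?_
      gcongr
      exact (hball _ (hmem t ht')).1.1.le
    · exact le_rfl

/-- A function on a preconnected open set whose differential is bounded by a multiple of the
function itself vanishes as soon as it vanishes at one point. -/
theorem eq_zero_of_abs_mvfderiv_le {w : M → ℝ} {s : Set M} (hs : IsOpen s) (hs' : IsPreconnected s)
    (hw : ∀ x ∈ s, MDiffAt w x) {C : ℝ}
    (hC : ∀ x ∈ s, ∀ v : TangentSpace 𝓘(ℝ, E) x, |mvfderiv 𝓘(ℝ, E) w x v| ≤ C * ‖v‖ * |w x|)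
    {p : M} (hp : p ∈ s) (hwp : w p = 0) {x : M} (hx : x ∈ s) : w x = 0 := by
  have hloc {x : M} (hx : x ∈ s) (hwx : w x = 0) : x ∈ interior {y | y ∈ s ∧ w y = 0} :=
    mem_interior_iff_mem_nhds.2 (eventually_eq_zero_of_abs_mvfderiv_le (hs.mem_nhds hx) hw hC hwx)
  refine (interior_subset (hs'.subset_of_closure_inter_subset isOpen_interior
    ⟨p, hp, hloc hp hwp⟩ ?_ hx)).2
  rintro y ⟨hy, hys⟩
  refine hloc hys ?_
  have h1 : y ∈ closure {y | y ∈ s ∧ w y = 0} := closure_mono interior_subset hy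
  have h2 := mem_closure_iff_frequently.1 h1
  by_contra hne
  have h3 := (hw y hys).continuousAt.eventually_ne hne
  obtain ⟨z, hz, hz'⟩ := (h2.and_eventually h3).exists
  exact hz' hz.2

end

/-! ### Superlevel sets at regular points, lengths, and isolated critical points. -/

section

variable {E : Type*} [NormedAddCommGroup E] [NormedSpace ℝ E]

/-- Near a regular point `a`, the part of the domain where `u > u a` is path connected, in the sense
that points close to `a` can be joined by paths that remain close to `a`. -/
theorem eventually_joinedIn_superlevel_of_hasStrictFDerivAt {u : E → ℝ} {L : E →L[ℝ] ℝ} {a : E}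
    (hu : HasStrictFDerivAt u L a) (hL : L ≠ 0) {s : Set E} (hs : s ∈ 𝓝 a) :
    ∃ r > 0, ∀ y ∈ Metric.ball a r, ∀ z ∈ Metric.ball a r, u a < u y → u a < u z →
      JoinedIn {w | w ∈ s ∧ u a < u w} y z := by
  obtain ⟨d, hd⟩ : ∃ d, L d = 1 := by
    obtain ⟨d, hd⟩ : ∃ d, L d ≠ 0 := by
      by_contra! h
      exact hL (ContinuousLinearMap.ext h)
    exact ⟨(L d)⁻¹ • d, by simp [hd]⟩
  -- With linearization error `ε` and `ε‖d‖ ≤ 1/2`, the function increases along `d` at rate at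
  -- least `1/2`, because `L d = 1`.
  set ε : ℝ := 1 / (2 * (‖d‖ + 1)) with hε
  have hε0 : 0 < ε := by positivity
  have hεd : ε * ‖d‖ ≤ 1 / 2 := by
    rw [hε, div_mul_eq_mul_div, one_mul, div_le_div_iff₀ (by positivity) (by norm_num)]
    linarith
  have h1 := hu.isLittleO.def hε0
  rw [nhds_prod_eq] at h1
  obtain ⟨t, ht, hts⟩ := Filter.eventually_prod_self_iff'.1 h1
  obtain ⟨R, hR, hRs⟩ := Metric.mem_nhds_iff.1 (inter_mem ht hs)
  -- The height of the lift along `d`: small enough to stay in the ball of radius `R`.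
  set τ : ℝ := R / (2 * (‖d‖ + 1)) with hτ
  have hτ0 : 0 < τ := by positivity
  have hτd : τ * ‖d‖ < R / 2 := by
    rw [hτ, div_mul_eq_mul_div, div_lt_div_iff₀ (by positivity) (by norm_num)]
    nlinarith
  -- On the ball of radius `r` the terms in `b - a` cost less than `τ / 2`, the amount gained by the
  -- lift; so the lifted ball lies above the level `u a`.
  set r : ℝ := min (R / 2) (τ / (2 * (‖L‖ + ε))) with hr
  have hr0 : 0 < r := lt_min (by positivity) (by positivity)
  have hrR : r ≤ R / 2 := min_le_left _ _
  have hrτ : (‖L‖ + ε) * r ≤ τ / 2 := by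
    have : r ≤ τ / (2 * (‖L‖ + ε)) := min_le_right _ _
    rw [le_div_iff₀ (by positivity)] at this
    linarith
  have hest {b c : E} (hb : b ∈ Metric.ball a R) (hc : c ∈ Metric.ball a R) :
      u c + L (b - c) - ε * ‖b - c‖ ≤ u b := by
    have := hts b (hRs hb).1 c (hRs hc).1
    rw [Real.norm_eq_abs, abs_le] at this
    linarith [this.1]
  have hshift {b : E} (hb : b ∈ Metric.ball a r) {θ : ℝ} (hθ : θ ∈ Icc 0 τ) :
      b + θ • d ∈ Metric.ball a R := by
    rw [mem_ball_iff_norm] at hb ⊢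
    calc ‖b + θ • d - a‖ = ‖(b - a) + θ • d‖ := by congr 1; abel
      _ ≤ ‖b - a‖ + ‖θ • d‖ := norm_add_le _ _
      _ ≤ ‖b - a‖ + τ * ‖d‖ := by
        rw [norm_smul, Real.norm_eq_abs, abs_of_nonneg hθ.1]
        gcongr
        exact hθ.2
      _ < R := by linarith
  have hball : Metric.ball a r ⊆ Metric.ball a R := Metric.ball_subset_ball (by linarith)
  have hup {b : E} (hb : b ∈ Metric.ball a r) (hub : u a < u b) :
      JoinedIn {w | w ∈ s ∧ u a < u w} b (b + τ • d) := by
    refine JoinedIn.of_segment_subset ?_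
    rintro _ hw
    rw [segment_eq_image'] at hw
    obtain ⟨θ, hθ, rfl⟩ := hw
    have hθτ : θ * τ ∈ Icc 0 τ := ⟨mul_nonneg hθ.1 hτ0.le, mul_le_of_le_one_left hτ0.le hθ.2⟩
    have he : b + θ • (b + τ • d - b) = b + (θ * τ) • d := by
      rw [add_sub_cancel_left, smul_smul]
    simp only [he]
    refine ⟨(hRs (hshift hb hθτ)).2, hub.trans_le ?_⟩
    have := hest (hshift hb hθτ) (hball hb)
    rw [add_sub_cancel_left, map_smul, hd, norm_smul, Real.norm_eq_abs, abs_of_nonneg hθτ.1,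
      smul_eq_mul] at this
    have h3 := mul_le_mul_of_nonneg_left hεd hθτ.1
    nlinarith [hθτ.1]
  -- The path goes up from `y` to `y + τ d`, across the lifted segment, and down to `z`.
  refine ⟨r, hr0, fun y hy z hz huy huz ↦ ((hup hy huy).trans ?_).trans (hup hz huz).symm⟩
  refine JoinedIn.of_segment_subset ?_
  intro w hw
  rw [add_comm y, add_comm z, ← segment_translate_image] at hw
  obtain ⟨b, hb, rfl⟩ := hw
  have hb : b ∈ Metric.ball a r := (convex_ball a r).segment_subset hy hz hb
  have hτ' : τ ∈ Icc 0 τ := ⟨hτ0.le, le_rfl⟩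
  have hb' := hshift hb hτ'
  simp only [add_comm (τ • d)]
  refine ⟨(hRs hb').2, ?_⟩
  have h4 := hest hb' (Metric.mem_ball_self hR)
  rw [mem_ball_iff_norm] at hb
  have h5 : b + τ • d - a = (b - a) + τ • d := by abel
  have h6 : ‖b + τ • d - a‖ ≤ ‖b - a‖ + τ * ‖d‖ := by
    rw [h5]
    refine (norm_add_le _ _).trans_eq ?_
    rw [norm_smul, Real.norm_eq_abs, abs_of_pos hτ0]
  have h7 : L (b + τ • d - a) = L (b - a) + τ := by
    rw [h5, map_add, map_smul, hd, smul_eq_mul, mul_one]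
  have h8 : -(‖L‖ * ‖b - a‖) ≤ L (b - a) := (abs_le.1 (L.le_opNorm (b - a))).1
  have h9 : ε * ‖b + τ • d - a‖ ≤ ε * ‖b - a‖ + τ * (1 / 2) := by
    refine (mul_le_mul_of_nonneg_left h6 hε0.le).trans ?_
    have := mul_le_mul_of_nonneg_left hεd hτ0.le
    linarith
  have h10 : (‖L‖ + ε) * ‖b - a‖ < (‖L‖ + ε) * r :=
    mul_lt_mul_of_pos_left hb (by positivity)
  linarith

variable {M : Type*} [TopologicalSpace M] [ChartedSpace E M]

/-- Functions whose differential has norm at most one are bounded by the length along paths. -/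
theorem ofReal_sub_le_pathELength [RiemannianBundle (fun x : M ↦ TangentSpace 𝓘(ℝ, E) x)]
    {g : M → ℝ} {γ : ℝ → M} {a b : ℝ} (hab : a ≤ b) (hγ : ContMDiffOn 𝓘(ℝ) 𝓘(ℝ, E) 1 γ (Icc a b))
    (hg : ∀ t ∈ Icc a b, ContMDiffAt 𝓘(ℝ, E) 𝓘(ℝ) 1 g (γ t))
    (hg' : ∀ t ∈ Icc a b, ∀ v, |mvfderiv 𝓘(ℝ, E) g (γ t) v| ≤ ‖v‖) :
    ENNReal.ofReal (g (γ b) - g (γ a)) ≤ Manifold.pathELength 𝓘(ℝ, E) γ a b := by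
  rcases hab.eq_or_lt with rfl | hab'
  · simp
  have hc : ContDiffOn ℝ 1 (g ∘ γ) (Icc a b) := by
    rw [← contMDiffOn_iff_contDiffOn]
    exact fun t ht ↦ (hg t ht).comp_contMDiffWithinAt t (hγ t ht)
  have h1 := enorm_sub_le_lintegral_derivWithin_Icc_of_contDiffOn_Icc hc hab
  rw [Manifold.pathELength_eq_lintegral_mfderivWithin_Icc]
  refine le_trans ?_ (h1.trans ?_)
  · rw [← ofReal_norm]
    exact ENNReal.ofReal_le_ofReal (le_abs_self _)
  · refine MeasureTheory.setLIntegral_mono' measurableSet_Icc fun t ht ↦ ?_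
    have hm := mvfderiv_comp_mfderivWithin (I := 𝓘(ℝ, E)) (I' := 𝓘(ℝ)) t
      ((hg t ht).mdifferentiableAt one_ne_zero)
      ((hγ t ht).mdifferentiableWithinAt one_ne_zero)
      (uniqueMDiffWithinAt_iff_uniqueDiffWithinAt.2 (uniqueDiffOn_Icc hab' t ht))
    have hm' : derivWithin (g ∘ γ) (Icc a b) t
        = mvfderiv 𝓘(ℝ, E) g (γ t) (mfderivWithin 𝓘(ℝ) 𝓘(ℝ, E) γ (Icc a b) t 1) := by
      rw [← fderivWithin_derivWithin]
      have := congrArg (fun T ↦ T (1 : ℝ)) hm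
      refine Eq.trans ?_ this
      simp only [mvfderivWithin, mfderivWithin_eq_fderivWithin]
      rfl
    rw [hm', ← ofReal_norm, ← ofReal_norm]
    exact ENNReal.ofReal_le_ofReal (hg' t ht _)

variable [IsManifold 𝓘(ℝ, E) ∞ M]

theorem exists_mem_nhds_joinedIn_superlevel {u : M → ℝ} {x : M}
    (hu : ContMDiffAt 𝓘(ℝ, E) 𝓘(ℝ) 1 u x) (hx : mvfderiv 𝓘(ℝ, E) u x ≠ 0) {s : Set M}
    (hs : s ∈ 𝓝 x) :
    ∃ N ∈ 𝓝 x, ∀ y ∈ N, ∀ z ∈ N, u x < u y → u x < u z →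
      JoinedIn {w | w ∈ s ∧ u x < u w} y z := by
  set ψ := extChartAt 𝓘(ℝ, E) x with hψ
  set e := trivializationAt E (TangentSpace 𝓘(ℝ, E) : M → Type _) x with he
  have hψx : ψ.symm (ψ x) = x := extChartAt_to_inv x
  have hxt : ψ x ∈ ψ.target := mem_extChartAt_target x
  have hcd : ContDiffAt ℝ 1 (fun z ↦ u (ψ.symm z)) (ψ x) := by
    simpa using! (contMDiffAt_iff.1 hu).2
  have hd := hasFDerivAt_comp_extChartAt_symm x hxt (u := u)
    (by rw [hψx]; exact hu.mdifferentiableAt one_ne_zero)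
  have hst := hcd.hasStrictFDerivAt' hd one_ne_zero
  have hne : (mvfderiv 𝓘(ℝ, E) u (ψ.symm (ψ x))).comp (e.symmL ℝ (ψ.symm (ψ x))) ≠ 0 := by
    rw [hψx]
    intro h
    refine hx (ContinuousLinearMap.ext fun v ↦ ?_)
    have := congrArg (fun T ↦ T (e.continuousLinearMapAt ℝ x v)) h
    rw [ContinuousLinearMap.comp_apply, Trivialization.symmL_continuousLinearMapAt _
      (FiberBundle.mem_baseSet_trivializationAt ..)] at this
    exact this
  have hcont : ContinuousAt ψ.symm (ψ x) := continuousAt_extChartAt_symm x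
  have hs' : ψ.symm ⁻¹' s ∩ ψ.target ∈ 𝓝 (ψ x) :=
    inter_mem (hcont.preimage_mem_nhds (by rwa [hψx])) (extChartAt_target_mem_nhds x)
  obtain ⟨r, hr, hjoin⟩ := eventually_joinedIn_superlevel_of_hasStrictFDerivAt hst hne hs'
  refine ⟨ψ ⁻¹' Metric.ball (ψ x) r ∩ ψ.source, inter_mem
    ((continuousAt_extChartAt x).preimage_mem_nhds (Metric.ball_mem_nhds _ hr))
    (extChartAt_source_mem_nhds x), fun y hy z hz huy huz ↦ ?_⟩
  have h := hjoin _ hy.1 _ hz.1 (by rwa [hψx, ψ.left_inv hy.2]) (by rwa [hψx, ψ.left_inv hz.2])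
  have h2 := h.map_continuousOn (f := ψ.symm)
    ((continuousOn_extChartAt_symm x).mono fun w hw ↦ hw.1.2)
  rw [ψ.left_inv hy.2, ψ.left_inv hz.2] at h2
  refine h2.mono ?_
  rintro _ ⟨w, hw, rfl⟩
  exact ⟨hw.1.1, by simpa [hψx] using hw.2⟩

/-- A critical point where the Hessian is a nonzero multiple of the metric is isolated. -/
theorem eventually_mvfderiv_ne_zero [RiemannianBundle (fun x : M ↦ TangentSpace 𝓘(ℝ, E) x)]
    [IsContMDiffRiemannianBundle 𝓘(ℝ, E) ∞ E (fun x : M ↦ TangentSpace 𝓘(ℝ, E) x)]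
    [FiniteDimensional ℝ E] {u : M → ℝ} {x : M}
    (hu : ContMDiffAt 𝓘(ℝ, E) 𝓘(ℝ) 2 u x) (hx : mvfderiv 𝓘(ℝ, E) u x = 0) {c : ℝ} (hc : c ≠ 0)
    (hh : ∀ v w : TangentSpace 𝓘(ℝ, E) x, hessian 𝓘(ℝ, E) u x v w = c * inner ℝ v w) :
    ∀ᶠ y in 𝓝[≠] x, mvfderiv 𝓘(ℝ, E) u y ≠ 0 := by
  set ψ := extChartAt 𝓘(ℝ, E) x with hψ
  set e := trivializationAt E (TangentSpace 𝓘(ℝ, E) : M → Type _) x with he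
  have hψx : ψ.symm (ψ x) = x := extChartAt_to_inv x
  have hxt : ψ x ∈ ψ.target := mem_extChartAt_target x
  have hxe : x ∈ e.baseSet := FiberBundle.mem_baseSet_trivializationAt ..
  -- The functions `du(Z i)` vanish together where `du` does. By the Hessian equation their
  -- differentials at `x` are `c ⟨·, b i⟩`, which are jointly injective, so the zero at `x` is
  -- isolated.
  let b := Module.finBasis ℝ (TangentSpace 𝓘(ℝ, E) x)
  let Z (i) : Π x : M, TangentSpace 𝓘(ℝ, E) x := FiberBundle.extend E (b i)
  have hZ (i) : MDiffAt (T% (Z i)) x := FiberBundle.mdifferentiableAt_extend ..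
  have hf (i) : MDiffAt (fun y ↦ mvfderiv 𝓘(ℝ, E) u y (Z i y)) x :=
    mdifferentiableAt_mvfderiv_apply hu (hZ i)
  have hd (i) : HasFDerivAt (fun z ↦ mvfderiv 𝓘(ℝ, E) u (ψ.symm z) (Z i (ψ.symm z)))
      ((mvfderiv 𝓘(ℝ, E) (fun y ↦ mvfderiv 𝓘(ℝ, E) u y (Z i y)) x).comp (e.symmL ℝ x)) (ψ x) := by
    have := hasFDerivAt_comp_extChartAt_symm x hxt (u := fun y ↦ mvfderiv 𝓘(ℝ, E) u y (Z i y))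
      (by rw [hψx]; exact hf i)
    rwa [hψx] at this
  have hF := hasFDerivAt_pi.2 hd
  obtain ⟨K, -, hK⟩ := LinearMap.exists_antilipschitzWith (ContinuousLinearMap.pi fun i ↦
    (mvfderiv 𝓘(ℝ, E) (fun y ↦ mvfderiv 𝓘(ℝ, E) u y (Z i y)) x).comp (e.symmL ℝ x)).toLinearMap (by
      refine LinearMap.ker_eq_bot'.2 fun w hw ↦ ?_
      have h0 : e.symmL ℝ x w = 0 := by
        refine InnerProductSpace.ext_inner_left_basis (𝕜 := ℝ) b fun i ↦ ?_
        have h1 : mvfderiv 𝓘(ℝ, E) (fun y ↦ mvfderiv 𝓘(ℝ, E) u y (Z i y)) x (e.symmL ℝ x w) = 0 :=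
          congrFun hw i
        rw [mvfderiv_mvfderiv_apply hu hx (hZ i), hh, show Z i x = b i from FiberBundle.extend_apply_self E (b i)] at h1
        rw [inner_zero_right, real_inner_comm]
        exact (mul_eq_zero.1 h1).resolve_left hc
      rw [← e.continuousLinearMapAt_symmL (R := ℝ) hxe w, h0, map_zero])
  have h1 := hF.eventually_ne (c := 0) ⟨K, hK⟩
  have h2 : Tendsto ψ (𝓝[≠] x) (𝓝[≠] (ψ x)) := by
    refine tendsto_nhdsWithin_iff.2 ⟨(continuousAt_extChartAt x).mono_left nhdsWithin_le_nhds, ?_⟩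
    filter_upwards [self_mem_nhdsWithin,
      nhdsWithin_le_nhds (extChartAt_source_mem_nhds (I := 𝓘(ℝ, E)) x)] with y hy hys h
    exact hy (ψ.injOn hys (mem_extChartAt_source x) h)
  filter_upwards [h2.eventually h1,
      nhdsWithin_le_nhds (extChartAt_source_mem_nhds (I := 𝓘(ℝ, E)) x)] with y hy hys h
  refine hy (funext fun i ↦ ?_)
  rw [ψ.left_inv hys, h]
  simp

end

/-! ### Mountain pass: an isolated maximum is the only one. -/

section MountainPass

variable {X : Type*} [TopologicalSpace X] {Ω : Set X} {u : X → ℝ} {m : ℝ} {p q : X}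

/-- Otherwise split `{u > c}` into the path component of `p` and the rest. By regularity their
closures do not meet inside the compact set `{u ≥ c}`, which they cover, so disjoint open sets
separate them. By compactness these open sets still cover `{u > s}` for some `s < c`, and a path
there from `p` to `q` would be disconnected. -/
theorem joinedIn_superlevel_of_forall_lt [T2Space X] [LocallyPathConnectedSpace X] (hΩ : IsOpen Ω)
    (hu : ContinuousOn u Ω) (hcomp : ∀ s > 0, IsCompact {x | x ∈ Ω ∧ s ≤ u x}) {c : ℝ} (hc : 0 < c)
    (hup : ∀ x ∈ Ω, u x = c → ∃ᶠ y in 𝓝 x, u x < u y)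
    (hreg : ∀ x ∈ Ω, u x = c → ∃ N ∈ 𝓝 x, ∀ y ∈ N, ∀ z ∈ N, c < u y → c < u z →
      JoinedIn {w | w ∈ Ω ∧ c < u w} y z) (hp : p ∈ Ω) (hq : q ∈ Ω) (hup' : c < u p)
    (huq : c < u q)
    (hJ : ∀ s < c, JoinedIn {w | w ∈ Ω ∧ s < u w} p q) : JoinedIn {w | w ∈ Ω ∧ c < u w} p q := by
  by_contra hcon
  set S := {w | w ∈ Ω ∧ c < u w} with hS
  have hSo : IsOpen S := hu.isOpen_inter_preimage hΩ isOpen_Ioi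
  set U := {y | JoinedIn S p y} with hU
  set K := {x | x ∈ Ω ∧ c ≤ u x} with hK
  have hKc : IsCompact K := hcomp c hc
  have hdisj : Disjoint (K ∩ closure U) (K ∩ closure (S \ U)) := by
    rw [Set.disjoint_left]
    rintro x ⟨⟨hxΩ, hxc⟩, h1⟩ ⟨-, h2⟩
    obtain ⟨N, hN, hN'⟩ : ∃ N ∈ 𝓝 x, ∀ y ∈ N, ∀ z ∈ N, c < u y → c < u z → JoinedIn S y z := by
      rcases hxc.eq_or_lt with hxc | hxc
      · exact hreg x hxΩ hxc.symm
      · refine ⟨pathComponentIn S x, (hSo.pathComponentIn x).mem_nhds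
          (mem_pathComponentIn_self ⟨hxΩ, hxc⟩), fun y hy z hz _ _ ↦ ?_⟩
        exact JoinedIn.trans (JoinedIn.symm hy) hz
    obtain ⟨y, hyN, hy⟩ := mem_closure_iff_nhds.1 h1 N hN
    obtain ⟨z, hzN, hz⟩ := mem_closure_iff_nhds.1 h2 N hN
    exact hz.2 (JoinedIn.trans hy (hN' y hyN z hzN hy.target_mem.2 hz.1.2))
  obtain ⟨V₁, V₂, hV₁, hV₂, hK₁, hK₂, hV⟩ := SeparatedNhds.of_isCompact_isCompact
    (hKc.inter_right isClosed_closure) (hKc.inter_right isClosed_closure) hdisj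
  have hKV : K ⊆ V₁ ∪ V₂ := by
    rintro x ⟨hxΩ, hxc⟩
    have hxS : x ∈ closure S := by
      rcases hxc.eq_or_lt with hxc | hxc
      · refine mem_closure_iff_frequently.2 (((hup x hxΩ hxc.symm).and_eventually
          (hΩ.mem_nhds hxΩ)).mono fun y hy ↦ ⟨hy.2, by rw [hxc]; exact hy.1⟩)
      · exact subset_closure ⟨hxΩ, hxc⟩
    have : S = U ∪ S \ U := (union_sdiff_cancel fun y hy ↦ JoinedIn.target_mem hy).symm
    rw [this, closure_union] at hxS
    exact hxS.imp (fun h ↦ hK₁ ⟨⟨hxΩ, hxc⟩, h⟩) fun h ↦ hK₂ ⟨⟨hxΩ, hxc⟩, h⟩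
  obtain ⟨s, hs, hsV⟩ : ∃ s < c, {w | w ∈ Ω ∧ s < u w} ⊆ V₁ ∪ V₂ := by
    have hD : IsCompact ({x | x ∈ Ω ∧ c / 2 ≤ u x} \ (V₁ ∪ V₂)) :=
      (hcomp (c / 2) (by positivity)).diff (hV₁.union hV₂)
    rcases Set.eq_empty_or_nonempty ({x | x ∈ Ω ∧ c / 2 ≤ u x} \ (V₁ ∪ V₂)) with he | hne
    · refine ⟨c / 2, by linarith, fun x hx ↦ ?_⟩
      exact sdiff_eq_empty.1 he ⟨hx.1, hx.2.le⟩
    -- Take for `s` the largest value of `u` outside the separating sets; it is below `c` because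
    -- they cover `{u ≥ c}`.
    · obtain ⟨x, hx, hxmax⟩ := hD.exists_isMaxOn hne (hu.mono fun y hy ↦ hy.1.1)
      refine ⟨u x, ?_, fun y hy ↦ ?_⟩
      · by_contra! hcx
        exact hx.2 (hKV ⟨hx.1.1, hcx⟩)
      · by_contra hyV
        exact hy.2.not_ge (hxmax ⟨⟨hy.1, hx.1.2.trans hy.2.le⟩, hyV⟩)
  obtain ⟨γ, hγ⟩ := hJ s hs
  have hpV : p ∈ V₁ := hK₁ ⟨⟨hp, hup'.le⟩, subset_closure (show p ∈ U from JoinedIn.refl ⟨hp, hup'⟩)⟩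
  have hqV : q ∈ V₂ := hK₂ ⟨⟨hq, huq.le⟩, subset_closure (show q ∈ S \ U from ⟨⟨hq, huq⟩, hcon⟩)⟩
  have hrange : range γ ⊆ V₁ :=
    (isPreconnected_range γ.continuous).subset_left_of_subset_union hV₁ hV₂ hV
    (by rintro _ ⟨t, rfl⟩; exact hsV (hγ t)) ⟨p, ⟨0, γ.source⟩, hpV⟩
  exact Set.disjoint_left.1 hV (hrange ⟨1, γ.target⟩) hqV

/-- A path is compact, so `u` attains on it a minimum that still exceeds `s`. -/
theorem exists_gt_joinedIn_superlevel (hu : ContinuousOn u Ω) {s : ℝ}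
    (h : JoinedIn {w | w ∈ Ω ∧ s < u w} p q) : ∃ s' > s, JoinedIn {w | w ∈ Ω ∧ s' < u w} p q := by
  obtain ⟨γ, hγ⟩ := h
  obtain ⟨_, ⟨t, rfl⟩, ht⟩ := (isCompact_range γ.continuous).exists_isMinOn (f := u)
    ⟨_, mem_range_self 0⟩ (hu.mono (by rintro _ ⟨t, rfl⟩; exact (hγ t).1))
  obtain ⟨s', h1, h2⟩ := exists_between (hγ t).2
  exact ⟨s', h1, γ, fun τ ↦ ⟨(hγ τ).1, h2.trans_le (ht (mem_range_self τ))⟩⟩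

/-- A path from `p` to `q` must cross the frontier of a small compact neighbourhood of `p`, where
`u` is bounded by some `s < m`. -/
theorem exists_lt_not_joinedIn_superlevel [T2Space X] [LocallyCompactSpace X] (hΩ : IsOpen Ω)
    (hu : ContinuousOn u Ω) (hp : p ∈ Ω) (hiso : ∀ᶠ x in 𝓝[≠] p, u x < m) (hq : u q = m)
    (hpq : p ≠ q) : ∃ s < m, ¬ JoinedIn {w | w ∈ Ω ∧ s < u w} p q := by
  rw [eventually_nhdsWithin_iff] at hiso
  obtain ⟨K, hK, hKs, hKc⟩ := LocallyCompactSpace.local_compact_nhds p _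
    (inter_mem (hΩ.mem_nhds hp) hiso)
  have hqK : q ∉ K := fun h ↦ ((hKs h).2 hpq.symm).ne hq
  have hfK : frontier K ⊆ K := hKc.isClosed.frontier_subset
  have hfc : IsCompact (frontier K) := hKc.of_isClosed_subset isClosed_frontier hfK
  have hlt : ∀ x ∈ frontier K, u x < m := by
    intro x hx
    refine (hKs (hfK hx)).2 ?_
    rintro rfl
    exact hx.2 (mem_interior_iff_mem_nhds.2 hK)
  obtain ⟨s, hs, hsf⟩ : ∃ s < m, ∀ x ∈ frontier K, u x ≤ s := by
    rcases (frontier K).eq_empty_or_nonempty with he | hne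
    · exact ⟨m - 1, by linarith, by simp [he]⟩
    · obtain ⟨x, hx, hxm⟩ := hfc.exists_isMaxOn hne (hu.mono fun y hy ↦ (hKs (hfK hy)).1)
      exact ⟨u x, hlt x hx, hxm⟩
  refine ⟨s, hs, ?_⟩
  rintro ⟨γ, hγ⟩
  obtain ⟨_, ⟨t, rfl⟩, ht⟩ : (range γ ∩ frontier K).Nonempty := by
    by_contra hemp
    rw [not_nonempty_iff_eq_empty, ← disjoint_iff_inter_eq_empty] at hemp
    have hsub : range γ ⊆ interior K ∪ Kᶜ := by
      intro y hy
      by_cases hyK : y ∈ K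
      · refine Or.inl ?_
        by_contra hyi
        exact Set.disjoint_left.1 hemp hy ⟨subset_closure hyK, hyi⟩
      · exact Or.inr hyK
    have : range γ ⊆ interior K := (isPreconnected_range γ.continuous).subset_left_of_subset_union isOpen_interior
      hKc.isClosed.isOpen_compl (disjoint_compl_right.mono_left interior_subset) hsub
      ⟨p, ⟨0, γ.source⟩, mem_interior_iff_mem_nhds.2 hK⟩
    exact hqK (interior_subset (this ⟨1, γ.target⟩))
  exact (hγ t).2.not_ge (hsf _ ht)

/-- A mountain pass principle without compactness of paths: if superlevel sets are compact and all
points below the maximal level are regular, there is only one maximum point as soon as one of them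
is isolated. -/
theorem eq_of_isolated_max [T2Space X] [LocallyPathConnectedSpace X] [LocallyCompactSpace X]
    (hΩ : IsOpen Ω) (hΩc : IsPreconnected Ω) (hu : ContinuousOn u Ω) (hpos : ∀ x ∈ Ω, 0 < u x)
    (hcomp : ∀ s > 0, IsCompact {x | x ∈ Ω ∧ s ≤ u x})
    (hup : ∀ x ∈ Ω, u x < m → ∃ᶠ y in 𝓝 x, u x < u y)
    (hreg : ∀ x ∈ Ω, u x < m → ∃ N ∈ 𝓝 x, ∀ y ∈ N, ∀ z ∈ N, u x < u y → u x < u z →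
      JoinedIn {w | w ∈ Ω ∧ u x < u w} y z)
    (hp : p ∈ Ω) (hq : q ∈ Ω) (hpm : u p = m) (hqm : u q = m)
    (hiso : ∀ᶠ x in 𝓝[≠] p, u x < m) : p = q := by
  by_contra hpq
  obtain ⟨s₀, hs₀, hns₀⟩ := exists_lt_not_joinedIn_superlevel hΩ hu hp hiso hqm hpq
  -- The levels above which `p` and `q` can be joined. Its supremum lies below `m`, hence is
  -- attained by regularity, or by connectedness of `Ω` if it is `0`; yet a joinable level can
  -- always be raised.
  set A := {s | JoinedIn {w | w ∈ Ω ∧ s < u w} p q} with hA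
  have hanti {s s' : ℝ} (h : s ≤ s') (hs' : s' ∈ A) : s ∈ A :=
    JoinedIn.mono hs' fun w hw ↦ ⟨hw.1, h.trans_lt hw.2⟩
  have h0 : (0 : ℝ) ∈ A := by
    have h := (hΩ.isConnected_iff_isPathConnected.1 ⟨⟨p, hp⟩, hΩc⟩).joinedIn p hp q hq
    exact h.mono fun w hw ↦ ⟨hw, hpos w hw⟩
  have hbdd : BddAbove A := ⟨s₀, fun s hs ↦ le_of_not_gt fun h ↦ hns₀ (hanti h.le hs)⟩
  have hc0 : 0 ≤ sSup A := le_csSup hbdd h0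
  have hcm : sSup A < m :=
    (csSup_le ⟨0, h0⟩ fun s hs ↦ le_of_not_gt fun h ↦ hns₀ (hanti h.le hs)).trans_lt hs₀
  have hcA : sSup A ∈ A := by
    rcases hc0.eq_or_lt with hc0 | hc0
    · rwa [← hc0]
    · refine joinedIn_superlevel_of_forall_lt hΩ hu hcomp hc0 (fun x hx hxc ↦ hup x hx (hxc ▸ hcm))
        (fun x hx hxc ↦ ?_) hp hq (hpm ▸ hcm) (hqm ▸ hcm) fun s hs ↦ ?_
      · have := hreg x hx (hxc ▸ hcm)
        rwa [hxc] at this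
      · obtain ⟨s', hs', hss'⟩ := exists_lt_of_lt_csSup ⟨0, h0⟩ hs
        exact hanti hss'.le hs'
  obtain ⟨s', hs', h⟩ := exists_gt_joinedIn_superlevel hu hcA
  exact hs'.not_ge (le_csSup hbdd h)

end MountainPass

/-! ### Descent to a zero set, and the distance profile. -/

/-- If a nonnegative function `φ` on a compact set can be decreased at a rate arbitrarily close
to `1` at every point where it does not vanish, then the distance to its zero set is at most `φ`. -/
theorem exists_edist_le_of_descent {X : Type*} [EMetricSpace X] {K : Set X} (hK : IsCompact K)
    {φ : X → ℝ} (hφ : ContinuousOn φ K) (hφ0 : ∀ y ∈ K, 0 ≤ φ y)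
    (hdesc : ∀ y ∈ K, φ y ≠ 0 → ∀ c : ℝ, 0 < c → c < 1 → ∃ z ∈ K, ∃ δ : ℝ, 0 ≤ δ ∧
      edist y z ≤ ENNReal.ofReal δ ∧ φ z + c * δ < φ y) {x : X} (hx : x ∈ K) :
    ∃ q ∈ K, φ q = 0 ∧ edist x q ≤ ENNReal.ofReal (φ x) := by
  have step (c : ℝ) (hc : 0 < c) (hc1 : c < 1) :
      ∃ q ∈ K, φ q = 0 ∧ ENNReal.ofReal c * edist x q ≤ ENNReal.ofReal (φ x) := by
    have hcont : ContinuousOn (fun y ↦ ENNReal.ofReal (φ y) + ENNReal.ofReal c * edist x y) K := by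
      refine (ENNReal.continuous_ofReal.comp_continuousOn hφ).add ?_
      exact ((ENNReal.continuous_const_mul ENNReal.ofReal_ne_top).comp
        (continuous_const.edist continuous_id)).continuousOn
    -- As in Ekeland's principle, minimize `φ + c d(x, ·)`: a descent step from the minimizer would
    -- lower it further, so `φ` vanishes there.
    obtain ⟨y, hy, hmin⟩ := hK.exists_isMinOn ⟨x, hx⟩ hcont
    have hyx : ENNReal.ofReal (φ y) + ENNReal.ofReal c * edist x y ≤ ENNReal.ofReal (φ x) := by
      simpa using hmin hx
    have hfin : ENNReal.ofReal c * edist x y ≠ ⊤ :=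
      ((le_add_self.trans hyx).trans_lt ENNReal.ofReal_lt_top).ne
    refine ⟨y, hy, ?_, le_add_self.trans hyx⟩
    by_contra hne
    obtain ⟨z, hz, δ, hδ, hyz, hlt⟩ := hdesc y hy hne c hc hc1
    refine not_lt_of_ge (isMinOn_iff.1 hmin z hz) ?_
    calc ENNReal.ofReal (φ z) + ENNReal.ofReal c * edist x z
        ≤ ENNReal.ofReal (φ z) + ENNReal.ofReal c * (edist x y + ENNReal.ofReal δ) := by
          gcongr
          exact (edist_triangle x y z).trans (by gcongr)
      _ = ENNReal.ofReal (φ z + c * δ) + ENNReal.ofReal c * edist x y := by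
          rw [ENNReal.ofReal_add (hφ0 z hz) (by positivity), ENNReal.ofReal_mul hc.le]
          ring
      _ < ENNReal.ofReal (φ y) + ENNReal.ofReal c * edist x y := by
          refine ENNReal.add_lt_add_right hfin ?_
          have := hφ0 z hz
          exact (ENNReal.ofReal_lt_ofReal_iff (by nlinarith [mul_nonneg hc.le hδ])).2 hlt
  obtain ⟨q₀, hq₀, hφq₀, -⟩ := step (1 / 2) (by norm_num) (by norm_num)
  have hK0 : IsCompact (K ∩ φ ⁻¹' {0}) :=
    hK.of_isClosed_subset (hφ.preimage_isClosed_of_isClosed hK.isClosed isClosed_singleton)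
      inter_subset_left
  -- The zero nearest to `x` does not depend on `c`, which allows `c → 1`.
  obtain ⟨q, hq, hqmin⟩ := hK0.exists_isMinOn ⟨q₀, hq₀, hφq₀⟩
    (continuous_const.edist continuous_id : Continuous fun y ↦ edist x y).continuousOn
  refine ⟨q, hq.1, hq.2, ?_⟩
  have hlim : Tendsto (fun c : ℝ ↦ ENNReal.ofReal c * edist x q) (𝓝[<] 1)
      (𝓝 (ENNReal.ofReal 1 * edist x q)) := by
    refine ENNReal.Tendsto.mul_const ?_ (Or.inl (by simp))
    exact (ENNReal.continuous_ofReal.tendsto 1).mono_left nhdsWithin_le_nhds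
  rw [ENNReal.ofReal_one, one_mul] at hlim
  refine le_of_tendsto hlim ?_
  filter_upwards [Ioo_mem_nhdsLT zero_lt_one] with c hc
  obtain ⟨q', hq', h1, h2⟩ := step c hc.1 hc.2
  refine le_trans ?_ h2
  gcongr
  exact hqmin ⟨hq', h1⟩

/-- The solution of the ordinary differential equation `h' = -1/√G` with `h m = 0`, where
`G s = (m - s) (2 a + k (s + m))` vanishes to first order at `m`. The function `h` gives the
distance to the maximum point in terms of the value of the function. -/
theorem exists_profile {a k m : ℝ} (hm : 0 < m) (ha : 0 < a) (hk : 0 < a + k * m) :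
    ∃ h : ℝ → ℝ, Continuous h ∧ h m = 0 ∧ StrictAntiOn h (Iic m) ∧
      ∀ s ∈ Ioo 0 m, 0 < (m - s) * (2 * a + k * (s + m)) ∧ ContDiffAt ℝ 1 h s ∧
        HasDerivAt h (-(1 / √((m - s) * (2 * a + k * (s + m))))) s := by
  -- The second factor of `G` in the variable `x = m - s`. It is affine, with values `2(a + km)` at
  -- `x = 0` and `a + (a + km)` at `x = m`.
  let D : ℝ → ℝ := fun x ↦ 2 * a + k * (2 * m - x)
  have hD {x : ℝ} (hx : 0 ≤ x) (hxm : x ≤ m) : 0 < D x := by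
    simp only [D]
    rcases le_total 0 k with hk0 | hk0
    · have := mul_nonneg hk0 (show 0 ≤ 2 * m - x by linarith)
      linarith
    · have := mul_nonneg_of_nonpos_of_nonpos hk0 (show -x ≤ 0 by linarith)
      nlinarith
  -- The substitution `τ = √(m - s)` removes the singularity at `s = m` from the integral of `1/√G`.
  -- Truncating `τ²` at `m` keeps `F` continuous and positive on the whole line.
  let F : ℝ → ℝ := fun τ ↦ 2 / √(D (min (τ ^ 2) m))
  have hmin (τ : ℝ) : 0 < D (min (τ ^ 2) m) := hD (le_min (sq_nonneg τ) hm.le) (min_le_right _ _)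
  have hF : Continuous F := by
    refine continuous_const.div (by fun_prop) fun τ ↦ ?_
    exact (Real.sqrt_pos.2 (hmin τ)).ne'
  have hFpos (τ : ℝ) : 0 < F τ := div_pos two_pos (Real.sqrt_pos.2 (hmin τ))
  let P : ℝ → ℝ := fun y ↦ ∫ τ in (0 : ℝ)..y, F τ
  have hP (y : ℝ) : HasDerivAt P (F y) y :=
    intervalIntegral.integral_hasDerivAt_right (hF.intervalIntegrable _ _)
      (hF.stronglyMeasurableAtFilter _ _) hF.continuousAt
  have hP1 : ContDiff ℝ 1 P := by
    rw [contDiff_one_iff_deriv]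
    refine ⟨fun y ↦ (hP y).differentiableAt, ?_⟩
    rwa [show deriv P = F from funext fun y ↦ (hP y).deriv]
  have hPmono : StrictMono P := strictMono_of_deriv_pos fun y ↦ by
    rw [(hP y).deriv]
    exact hFpos y
  refine ⟨fun s ↦ P √(m - s), hP1.continuous.comp (by fun_prop), by simp [P], ?_, ?_⟩
  · intro s hs t ht hst
    exact hPmono (Real.sqrt_lt_sqrt (sub_nonneg.2 ht) (by linarith))
  · intro s hs
    have hms : 0 < m - s := by linarith [hs.2]
    have hDs : 0 < D (m - s) := hD hms.le (by linarith [hs.1])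
    have hDe : D (m - s) = 2 * a + k * (s + m) := by simp only [D]; ring
    have hsqrt : HasDerivAt (fun s ↦ √(m - s)) (-1 / (2 * √(m - s))) s :=
      ((hasDerivAt_id s).const_sub m).sqrt hms.ne'
    refine ⟨hDe ▸ mul_pos hms hDs, ?_, ?_⟩
    · refine hP1.contDiffAt.comp s ?_
      exact (contDiffAt_const.sub contDiffAt_id).sqrt hms.ne'
    · refine ((hP _).comp s hsqrt).congr_deriv ?_
      simp only [F]
      rw [Real.sq_sqrt hms.le, min_eq_left (by linarith [hs.1]), ← hDe, Real.sqrt_mul hms.le]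
      have h1 := (Real.sqrt_pos.2 hms).ne'
      have h2 := (Real.sqrt_pos.2 hDs).ne'
      field_simp

/-! ### The equation: first integral and the degenerate case. -/

section

variable {E : Type*} [NormedAddCommGroup E] [NormedSpace ℝ E]
  {M : Type*} [TopologicalSpace M] [ChartedSpace E M] [IsManifold 𝓘(ℝ, E) ∞ M]

theorem mvfderiv_eq_zero_of_isLocalMax {u : M → ℝ} {x : M} (hu : MDiffAt u x)
    (hx : IsLocalMax u x) : mvfderiv 𝓘(ℝ, E) u x = 0 := by
  ext v
  have hc := continuousAt_chartLine x v
  have h : IsLocalMax (fun t ↦ u (chartLine x v t)) 0 := by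
    have := hc.eventually (p := fun y ↦ u y ≤ u x) (by rw [chartLine_zero]; exact hx)
    simpa [IsLocalMax, IsMaxFilter, chartLine_zero] using this
  simpa using h.hasDerivAt_eq_zero (hasDerivAt_comp_chartLine x v hu)

end

section

variable {E : Type*} [NormedAddCommGroup E] [NormedSpace ℝ E] [FiniteDimensional ℝ E]
  {M : Type*} [EMetricSpace M] [ChartedSpace E M] [IsManifold 𝓘(ℝ, E) ∞ M]
  [RiemannianBundle (fun x : M ↦ TangentSpace 𝓘(ℝ, E) x)]
  [IsContMDiffRiemannianBundle 𝓘(ℝ, E) ∞ E (fun x : M ↦ TangentSpace 𝓘(ℝ, E) x)]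

/-- Positive solutions of `∇²u = -(a + k u) g` in a relatively compact domain, with zero boundary
values. -/
structure IsHessianSolution (a k : ℝ) (Ω : Set M) (u : M → ℝ) : Prop where
  isOpen : IsOpen Ω
  isPreconnected : IsPreconnected Ω
  isCompact_closure : IsCompact (closure Ω)
  continuousOn : ContinuousOn u (closure Ω)
  contMDiffOn : ContMDiffOn 𝓘(ℝ, E) 𝓘(ℝ) 2 u Ω
  hessian_eq : ∀ x ∈ Ω, ∀ v w : TangentSpace 𝓘(ℝ, E) x,
    hessian 𝓘(ℝ, E) u x v w = -(a + k * u x) * inner ℝ v w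
  pos : ∀ x ∈ Ω, 0 < u x
  eq_zero : ∀ x ∈ frontier Ω, u x = 0

namespace IsHessianSolution

variable {a k : ℝ} {Ω : Set M} {u : M → ℝ} {p x y : M}

theorem contMDiffAt (h : IsHessianSolution (E := E) a k Ω u) (hx : x ∈ Ω) :
    ContMDiffAt 𝓘(ℝ, E) 𝓘(ℝ) 2 u x :=
  h.contMDiffOn.contMDiffAt (h.isOpen.mem_nhds hx)

theorem mdifferentiableAt (h : IsHessianSolution (E := E) a k Ω u) (hx : x ∈ Ω) :
    MDifferentiableAt 𝓘(ℝ, E) 𝓘(ℝ) u x :=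
  (h.contMDiffAt hx).mdifferentiableAt two_ne_zero

theorem mem_frontier (h : IsHessianSolution (E := E) a k Ω u) (hx : x ∈ closure Ω)
    (hx' : x ∉ Ω) : x ∈ frontier Ω :=
  ⟨hx, by rwa [h.isOpen.interior_eq]⟩

theorem exists_isMaxOn (h : IsHessianSolution (E := E) a k Ω u) (hne : Ω.Nonempty) :
    ∃ p ∈ Ω, IsMaxOn u (closure Ω) p := by
  obtain ⟨y, hy⟩ := hne
  obtain ⟨p, hp, hmax⟩ := h.isCompact_closure.exists_isMaxOn ⟨y, subset_closure hy⟩ h.continuousOn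
  refine ⟨p, by_contra fun hpΩ ↦ ?_, hmax⟩
  have h1 := h.eq_zero p (h.mem_frontier hp hpΩ)
  have h2 : u y ≤ u p := hmax (subset_closure hy)
  linarith [h.pos y hy]

/-- Since `u` vanishes on the frontier, a positive superlevel set is closed in the compact closure.
This takes the place of completeness. -/
theorem isCompact_superlevel (h : IsHessianSolution (E := E) a k Ω u) {s : ℝ} (hs : 0 < s) :
    IsCompact {x | x ∈ Ω ∧ s ≤ u x} := by
  have : {x | x ∈ Ω ∧ s ≤ u x} = closure Ω ∩ u ⁻¹' Ici s := by
    ext x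
    refine ⟨fun hx ↦ ⟨subset_closure hx.1, hx.2⟩, fun hx ↦ ⟨by_contra fun hxΩ ↦ ?_, hx.2⟩⟩
    have h1 := h.eq_zero x (h.mem_frontier hx.1 hxΩ)
    have h2 : s ≤ u x := hx.2
    linarith
  rw [this]
  exact h.isCompact_closure.of_isClosed_subset
    (h.continuousOn.preimage_isClosed_of_isClosed isClosed_closure isClosed_Ici) inter_subset_left

theorem le_max (hmax : IsMaxOn u (closure Ω) p) (hx : x ∈ Ω) : u x ≤ u p :=
  hmax (subset_closure hx)

theorem mvfderiv_eq_zero_of_eq_max (h : IsHessianSolution (E := E) a k Ω u)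
    (hmax : IsMaxOn u (closure Ω) p) (hx : x ∈ Ω) (hxp : u x = u p) :
    mvfderiv 𝓘(ℝ, E) u x = 0 := by
  refine mvfderiv_eq_zero_of_isLocalMax (h.mdifferentiableAt hx) ?_
  filter_upwards [h.isOpen.mem_nhds hx] with y hy
  rw [hxp]
  exact le_max hmax hy

/-- The first integral of the equation. -/
theorem inner_gradient_self (h : IsHessianSolution (E := E) a k Ω u) (hp : p ∈ Ω)
    (hmax : IsMaxOn u (closure Ω) p) (hx : x ∈ Ω) :
    inner ℝ (gradient 𝓘(ℝ, E) u x) (gradient 𝓘(ℝ, E) u x)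
      = (u p - u x) * (2 * a + k * (u x + u p)) := by
  set w : M → ℝ := fun y ↦ inner ℝ (gradient 𝓘(ℝ, E) u y) (gradient 𝓘(ℝ, E) u y)
    + (2 * a * u y + k * u y ^ 2) with hw
  have h1 {y} (hy : y ∈ Ω) := mvfderiv_first_integral (h.contMDiffAt hy) (h.hessian_eq y hy)
  have hwp : w p = 2 * a * u p + k * u p ^ 2 := by
    rw [hw]
    simp only
    rw [inner_gradient, h.mvfderiv_eq_zero_of_eq_max hmax hp rfl]
    simp
  let T : ℝ → ℝ := fun s ↦ s - w p
  have hT (s : ℝ) : HasDerivAt T 1 s := (hasDerivAt_id s).sub_const _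
  -- With `C = 0` this says that a function with zero differential is constant.
  have h2 := eq_zero_of_abs_mvfderiv_le (w := fun y ↦ T (w y)) h.isOpen h.isPreconnected
    (fun y hy ↦ mdifferentiableAt_real_comp (hT _) (h1 hy).1) (C := 0)
    (fun y hy v ↦ by rw [mvfderiv_real_comp (hT _) (h1 hy).1, (h1 hy).2]; simp) hp (sub_self _) hx
  have h3 : w x = w p := sub_eq_zero.1 h2
  rw [hwp, hw] at h3
  simp only at h3
  linear_combination h3

/-- If `a + km < 0`, the first integral writes `|∇u|²` near `p` as `m - u ≥ 0` times a negative
factor. So `u = m` near `p`, and the Hessian vanishes there, against the equation. -/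
theorem add_mul_max_nonneg [Nontrivial E] (h : IsHessianSolution (E := E) a k Ω u) (hp : p ∈ Ω)
    (hmax : IsMaxOn u (closure Ω) p) : 0 ≤ a + k * u p := by
  by_contra! hneg
  have hc : ContinuousAt u p := (h.mdifferentiableAt hp).continuousAt
  have h1 : ∀ᶠ y in 𝓝 p, 2 * a + k * (u y + u p) < 0 := by
    have : ContinuousAt (fun y ↦ 2 * a + k * (u y + u p)) p := by fun_prop
    exact this.eventually_lt_const (by linarith)
  have h2 : ∀ᶠ y in 𝓝 p, mvfderiv 𝓘(ℝ, E) u y = 0 := by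
    filter_upwards [h1, h.isOpen.mem_nhds hp] with y hy hyΩ
    refine h.mvfderiv_eq_zero_of_eq_max hmax hyΩ ?_
    have h3 := h.inner_gradient_self hp hmax hyΩ
    have h4 := real_inner_self_nonneg (x := gradient 𝓘(ℝ, E) u y)
    have h5 := le_max hmax hyΩ
    rw [h3] at h4
    nlinarith
  obtain ⟨v, hv⟩ := exists_ne (0 : E)
  let V : TangentSpace 𝓘(ℝ, E) p := v
  have hV : V ≠ 0 := hv
  have h3 := mvfderiv_mvfderiv_apply (h.contMDiffAt hp) h2.self_of_nhds
    (Z := FiberBundle.extend E V) (FiberBundle.mdifferentiableAt_extend ..) V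
  have h4 : (fun y ↦ mvfderiv 𝓘(ℝ, E) u y (FiberBundle.extend E V y)) =ᶠ[𝓝 p] fun _ ↦ (0 : ℝ) := by
    filter_upwards [h2] with y hy
    rw [hy]
    rfl
  have h5 : mvfderiv 𝓘(ℝ, E) (fun y ↦ mvfderiv 𝓘(ℝ, E) u y (FiberBundle.extend E V y)) p = 0 := by
    refine mvfderiv_eq_zero_of_isLocalMax (mdifferentiableAt_mvfderiv_apply (h.contMDiffAt hp)
      (FiberBundle.mdifferentiableAt_extend ..)) ?_
    filter_upwards [h4] with y hy
    exact (hy.trans h4.self_of_nhds.symm).le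
  rw [h5, FiberBundle.extend_apply_self, h.hessian_eq p hp] at h3
  have h6 := real_inner_self_nonneg (x := V)
  rcases mul_eq_zero.1 h3.symm with h7 | h7
  · linarith
  · exact hV (inner_self_eq_zero.1 h7)

/-- Both factors of the first integral now vanish at `u = m`, so `|∇u|` is linear in `|u - m|` and
Grönwall applies. -/
theorem eq_max_of_add_mul_max_eq_zero (h : IsHessianSolution (E := E) a k Ω u) (ha : 0 ≤ a)
    (hp : p ∈ Ω) (hmax : IsMaxOn u (closure Ω) p) (hzero : a + k * u p = 0) (hx : x ∈ Ω) :
    u x = u p := by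
  have hk : 0 ≤ -k := by
    by_contra! hk
    nlinarith [h.pos p hp]
  let T : ℝ → ℝ := fun s ↦ s - u p
  have hT (s : ℝ) : HasDerivAt T 1 s := (hasDerivAt_id s).sub_const _
  refine sub_eq_zero.1 (eq_zero_of_abs_mvfderiv_le (w := fun y ↦ T (u y)) h.isOpen h.isPreconnected
    (fun y hy ↦ mdifferentiableAt_real_comp (hT _) (h.mdifferentiableAt hy)) (C := √(-k))
    (fun y hy v ↦ ?_) hp (sub_self _) hx)
  rw [mvfderiv_real_comp (hT _) (h.mdifferentiableAt hy), one_mul, ← inner_gradient]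
  refine (abs_real_inner_le_norm _ _).trans_eq ?_
  have h1 : ‖gradient 𝓘(ℝ, E) u y‖ = √(-k) * |T (u y)| := by
    rw [norm_eq_sqrt_real_inner, h.inner_gradient_self hp hmax hy, ← Real.sqrt_sq_eq_abs,
      ← Real.sqrt_mul hk]
    congr 1
    simp only [T]
    linear_combination (2 * (u p - u y)) * hzero
  rw [h1]
  ring

variable [IsRiemannianManifold 𝓘(ℝ, E) M]

/-- Here `Ω` is clopen. Being connected it lies at finite distance from `p`, being compact it has a
farthest point, and no path from `p` leaves it. -/
theorem exists_eball_of_frontier_eq_empty (h : IsHessianSolution (E := E) a k Ω u) (hp : p ∈ Ω)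
    (hfr : frontier Ω = ∅) :
    ∃ ρ : ℝ, 0 < ρ ∧ Ω = Metric.eball p (ENNReal.ofReal ρ) := by
  have hclopen : IsClopen Ω := isClopen_iff_frontier_eq_empty.2 hfr
  have hsub : Ω ⊆ Metric.eball p ⊤ := h.isPreconnected.subset_isClopen
    ⟨Metric.isClosed_eball_top, Metric.isOpen_eball⟩ ⟨p, hp, Metric.mem_eball_self (by simp)⟩
  have hΩc : IsCompact Ω := hclopen.isClosed.closure_eq ▸ h.isCompact_closure
  obtain ⟨q, hq, hqmax⟩ := hΩc.exists_isMaxOn ⟨p, hp⟩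
    (continuous_id.edist continuous_const : Continuous fun y ↦ edist y p).continuousOn
  have hqfin : edist q p ≠ ⊤ := (hsub hq).ne
  -- Adding `1` puts the farthest point strictly inside and keeps the radius positive.
  refine ⟨(edist q p).toReal + 1, by positivity, subset_antisymm (fun y hy ↦ ?_) fun y hy ↦ ?_⟩
  · refine (show edist y p ≤ edist q p from hqmax hy).trans_lt ?_
    rw [ENNReal.lt_ofReal_iff_toReal_lt hqfin]
    linarith
  · rw [Metric.mem_eball', IsRiemannianManifold.out (I := 𝓘(ℝ, E))] at hy
    obtain ⟨γ, hγ0, hγ1, hγ, -⟩ := Manifold.exists_lt_of_riemannianEDist_lt hy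
    have h1 : γ '' Icc 0 1 ⊆ Ω := (isPreconnected_Icc.image γ hγ.continuousOn).subset_isClopen
      hclopen ⟨p, ⟨0, by simp, hγ0⟩, hp⟩
    exact hγ1 ▸ h1 (mem_image_of_mem γ (by simp))

end IsHessianSolution

end

/-! ### The nondegenerate case: the profile computes the distance to the maximum. -/

namespace IsHessianSolution

variable {E : Type*} [NormedAddCommGroup E] [NormedSpace ℝ E] [FiniteDimensional ℝ E]
  {M : Type*} [EMetricSpace M] [ChartedSpace E M] [IsManifold 𝓘(ℝ, E) ∞ M]
  [RiemannianBundle (fun x : M ↦ TangentSpace 𝓘(ℝ, E) x)]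
  [IsContMDiffRiemannianBundle 𝓘(ℝ, E) ∞ E (fun x : M ↦ TangentSpace 𝓘(ℝ, E) x)]
  {a k : ℝ} {Ω : Set M} {u : M → ℝ} {p x : M}

/-- If the maximum is nondegenerate, there is only one maximum point. -/
theorem eq_of_eq_max (h : IsHessianSolution (E := E) a k Ω u) (hp : p ∈ Ω)
    (hmax : IsMaxOn u (closure Ω) p) (hpos : a + k * u p ≠ 0)
    (hreg : ∀ y ∈ Ω, u y < u p → mvfderiv 𝓘(ℝ, E) u y ≠ 0) (hx : x ∈ Ω) (hxp : u x = u p) :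
    p = x := by
  have : LocallyPathConnectedSpace M := ChartedSpace.locallyPathConnectedSpace E M
  have : LocallyCompactSpace M := ChartedSpace.locallyCompactSpace E M
  refine eq_of_isolated_max h.isOpen h.isPreconnected (h.continuousOn.mono subset_closure) h.pos
    (fun s hs ↦ h.isCompact_superlevel hs) (fun y hy hyp ↦ ?_) (fun y hy hyp ↦ ?_) hp hx rfl hxp ?_
  · intro hev
    refine hreg y hy hyp (mvfderiv_eq_zero_of_isLocalMax (h.mdifferentiableAt hy) ?_)
    filter_upwards [hev] with z hz using not_lt.1 hz
  · exact exists_mem_nhds_joinedIn_superlevel ((h.contMDiffAt hy).of_le one_le_two)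
      (hreg y hy hyp) (h.isOpen.mem_nhds hy)
  · have h1 := eventually_mvfderiv_ne_zero (h.contMDiffAt hp)
      (h.mvfderiv_eq_zero_of_eq_max hmax hp rfl) (neg_ne_zero.2 hpos) (h.hessian_eq p hp)
    filter_upwards [h1, nhdsWithin_le_nhds (h.isOpen.mem_nhds hp)] with y hy hyΩ
    exact (le_max hmax hyΩ).lt_of_ne fun he ↦ hy (h.mvfderiv_eq_zero_of_eq_max hmax hyΩ he)

/-- Composition with the profile function turns a solution into a function whose gradient has norm
one away from the maximum points. -/
theorem mvfderiv_profile_comp (h : IsHessianSolution (E := E) a k Ω u) (hp : p ∈ Ω)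
    (hmax : IsMaxOn u (closure Ω) p) {f : ℝ → ℝ}
    (hf : ∀ s ∈ Ioo 0 (u p), 0 < (u p - s) * (2 * a + k * (s + u p)) ∧
      HasDerivAt f (-(1 / √((u p - s) * (2 * a + k * (s + u p))))) s)
    (hx : x ∈ Ω) (hxp : u x < u p) :
    0 < ‖gradient 𝓘(ℝ, E) u x‖ ∧ MDiffAt (fun y ↦ f (u y)) x ∧ ∀ v : TangentSpace 𝓘(ℝ, E) x,
      mvfderiv 𝓘(ℝ, E) (fun y ↦ f (u y)) x v
        = -(inner ℝ (gradient 𝓘(ℝ, E) u x) v / ‖gradient 𝓘(ℝ, E) u x‖) := by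
  obtain ⟨hG, hd⟩ := hf (u x) ⟨h.pos x hx, hxp⟩
  rw [← h.inner_gradient_self hp hmax hx] at hG hd
  rw [← norm_eq_sqrt_real_inner] at hd
  refine ⟨?_, mdifferentiableAt_real_comp hd (h.mdifferentiableAt hx), fun v ↦ ?_⟩
  · rw [norm_eq_sqrt_real_inner]
    exact Real.sqrt_pos.2 hG
  · rw [mvfderiv_real_comp hd (h.mdifferentiableAt hx), inner_gradient]
    ring

/-- The norm of the differential of `f ∘ u` is one only where `u < u p`. So the length estimate is
applied after the last time at which the path meets the maximal level, where `f ∘ u` is `0`. -/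
theorem ofReal_profile_le_pathELength (h : IsHessianSolution (E := E) a k Ω u) (hp : p ∈ Ω)
    (hmax : IsMaxOn u (closure Ω) p) {f : ℝ → ℝ} (hfc : Continuous f) (hf0 : f (u p) = 0)
    (hf : ∀ s ∈ Ioo 0 (u p), 0 < (u p - s) * (2 * a + k * (s + u p)) ∧ ContDiffAt ℝ 1 f s ∧
      HasDerivAt f (-(1 / √((u p - s) * (2 * a + k * (s + u p))))) s)
    {γ : ℝ → M} {T : ℝ} (hT : 0 ≤ T) (hγ : ContMDiffOn 𝓘(ℝ) 𝓘(ℝ, E) 1 γ (Icc 0 T))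
    (hγ0 : γ 0 = p) (hγΩ : ∀ t ∈ Icc 0 T, γ t ∈ Ω) :
    ENNReal.ofReal (f (u (γ T))) ≤ Manifold.pathELength 𝓘(ℝ, E) γ 0 T := by
  have hcont : ContinuousOn (fun t ↦ u (γ t)) (Icc 0 T) :=
    h.continuousOn.comp hγ.continuousOn fun t ht ↦ subset_closure (hγΩ t ht)
  obtain ⟨t₀, ⟨ht₀, htp⟩, hgr⟩ : ∃ t₀, IsGreatest (Icc 0 T ∩ (fun t ↦ u (γ t)) ⁻¹' {u p}) t₀ := by
    refine IsCompact.exists_isGreatest ?_ ⟨0, ⟨le_rfl, hT⟩, by simp [hγ0]⟩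
    exact isCompact_Icc.of_isClosed_subset
      (hcont.preimage_isClosed_of_isClosed isClosed_Icc isClosed_singleton) inter_subset_left
  have htp : u (γ t₀) = u p := htp
  rcases ht₀.2.eq_or_lt with rfl | htT
  · simp [htp, hf0]
  have hlt (t : ℝ) (ht : t ∈ Ioc t₀ T) : u (γ t) < u p := by
    have htI : t ∈ Icc 0 T := ⟨ht₀.1.trans ht.1.le, ht.2⟩
    exact (le_max hmax (hγΩ t htI)).lt_of_ne fun he ↦ ht.1.not_ge (hgr ⟨htI, he⟩)
  have hlim : Tendsto (fun t ↦ ENNReal.ofReal (f (u (γ T)) - f (u (γ t)))) (𝓝[>] t₀)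
      (𝓝 (ENNReal.ofReal (f (u (γ T)) - f (u (γ t₀))))) := by
    have h1 : Tendsto (fun t ↦ u (γ t)) (𝓝[>] t₀) (𝓝 (u (γ t₀))) := by
      refine (hcont t₀ ht₀).tendsto.mono_left ?_
      rw [← nhdsWithin_Ioo_eq_nhdsGT htT]
      exact nhdsWithin_mono _ fun t ht ↦ ⟨ht₀.1.trans ht.1.le, ht.2.le⟩
    exact ENNReal.tendsto_ofReal (((hfc.tendsto _).comp h1).const_sub _)
  rw [htp, hf0, sub_zero] at hlim
  refine le_of_tendsto hlim ?_
  filter_upwards [Ioo_mem_nhdsGT htT] with t ht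
  have hI {s : ℝ} (hs : s ∈ Icc t T) : s ∈ Ioc t₀ T := ⟨ht.1.trans_le hs.1, hs.2⟩
  have hI' {s : ℝ} (hs : s ∈ Icc t T) : s ∈ Icc 0 T := ⟨(ht₀.1.trans ht.1.le).trans hs.1, hs.2⟩
  refine (ofReal_sub_le_pathELength (g := fun y ↦ f (u y)) ht.2.le (hγ.mono fun s hs ↦ hI' hs)
    (fun s hs ↦ ?_) fun s hs v ↦ ?_).trans (Manifold.pathELength_mono (ht₀.1.trans ht.1.le) le_rfl)
  · have hs' := hγΩ s (hI' hs)
    exact (hf _ ⟨h.pos _ hs', hlt s (hI hs)⟩).2.1.contMDiffAt.comp (γ s)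
      ((h.contMDiffAt hs').of_le one_le_two)
  · have h2 := h.mvfderiv_profile_comp hp hmax (fun s hs ↦ ⟨(hf s hs).1, (hf s hs).2.2⟩)
      (hγΩ s (hI' hs)) (hlt s (hI hs))
    rw [h2.2.2, abs_neg, abs_div, abs_norm, div_le_iff₀ h2.1, mul_comm]
    exact abs_real_inner_le_norm _ _

variable [IsRiemannianManifold 𝓘(ℝ, E) M]

/-- The distance of `M` admits paths that leave `Ω`. Up to the first exit such a path runs in `Ω`
and `u` tends to `0` along it, so its length is at least `f 0`, the largest value of the profile. -/
theorem ofReal_profile_le_edist (h : IsHessianSolution (E := E) a k Ω u) (hp : p ∈ Ω)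
    (hmax : IsMaxOn u (closure Ω) p) {f : ℝ → ℝ} (hfc : Continuous f) (hf0 : f (u p) = 0)
    (hfanti : StrictAntiOn f (Iic (u p)))
    (hf : ∀ s ∈ Ioo 0 (u p), 0 < (u p - s) * (2 * a + k * (s + u p)) ∧ ContDiffAt ℝ 1 f s ∧
      HasDerivAt f (-(1 / √((u p - s) * (2 * a + k * (s + u p))))) s) (x : M) :
    (x ∈ Ω → ENNReal.ofReal (f (u x)) ≤ edist p x) ∧ (x ∉ Ω → ENNReal.ofReal (f 0) ≤ edist p x) := by
  have key {r : ENNReal} (hr : edist p x < r) : (x ∈ Ω ∧ ENNReal.ofReal (f (u x)) ≤ r) ∨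
      ENNReal.ofReal (f 0) ≤ r := by
    rw [IsRiemannianManifold.out (I := 𝓘(ℝ, E))] at hr
    obtain ⟨γ, hγ0, hγ1, hγ, hlen⟩ := Manifold.exists_lt_of_riemannianEDist_lt hr
    by_cases hΩ : ∀ t ∈ Icc (0 : ℝ) 1, γ t ∈ Ω
    · refine Or.inl ⟨hγ1 ▸ hΩ 1 (by simp), ?_⟩
      rw [← hγ1]
      exact (h.ofReal_profile_le_pathELength hp hmax hfc hf0 hf zero_le_one hγ hγ0 hΩ).trans hlen.le
    · push Not at hΩ
      right
      obtain ⟨T, ⟨hT, hTΩ⟩, hleast⟩ : ∃ T, IsLeast (Icc (0 : ℝ) 1 ∩ γ ⁻¹' Ωᶜ) T := by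
        obtain ⟨t, ht, htΩ⟩ := hΩ
        refine IsCompact.exists_isLeast ?_ ⟨t, ht, htΩ⟩
        exact isCompact_Icc.of_isClosed_subset (hγ.continuousOn.preimage_isClosed_of_isClosed
          isClosed_Icc h.isOpen.isClosed_compl) inter_subset_left
      have hT0 : 0 < T := hT.1.lt_of_ne fun he ↦ hTΩ (by rwa [← he, hγ0])
      have hin (t : ℝ) (ht : t ∈ Ico 0 T) : γ t ∈ Ω := by
        by_contra hc
        exact ht.2.not_ge (hleast ⟨⟨ht.1, ht.2.le.trans hT.2⟩, hc⟩)
      have hγT : Tendsto γ (𝓝[<] T) (𝓝[Ω] (γ T)) := by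
        refine tendsto_nhdsWithin_iff.2 ⟨?_, ?_⟩
        · refine (hγ.continuousOn T hT).tendsto.mono_left ?_
          rw [← nhdsWithin_Ioo_eq_nhdsLT hT0]
          exact nhdsWithin_mono _ fun t ht ↦ ⟨ht.1.le, ht.2.le.trans hT.2⟩
        · filter_upwards [Ioo_mem_nhdsLT hT0] with t ht using hin t ⟨ht.1.le, ht.2⟩
      have hTcl : γ T ∈ closure Ω := mem_closure_iff_nhdsWithin_neBot.2 (hγT.neBot)
      have hlim : Tendsto (fun t ↦ ENNReal.ofReal (f (u (γ t)))) (𝓝[<] T)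
          (𝓝 (ENNReal.ofReal (f (u (γ T))))) :=
        ENNReal.tendsto_ofReal ((hfc.tendsto _).comp (((h.continuousOn _ hTcl).mono_left
          (nhdsWithin_mono _ subset_closure)).comp hγT))
      rw [h.eq_zero _ (h.mem_frontier hTcl hTΩ)] at hlim
      refine le_of_tendsto hlim ?_
      filter_upwards [Ioo_mem_nhdsLT hT0] with t ht
      have ht1 : t ≤ 1 := ht.2.le.trans hT.2
      exact (h.ofReal_profile_le_pathELength hp hmax hfc hf0 hf ht.1.le
        (hγ.mono (Icc_subset_Icc_right ht1)) hγ0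
        fun s hs ↦ hin s ⟨hs.1, hs.2.trans_lt ht.2⟩).trans
        ((Manifold.pathELength_mono le_rfl ht1).trans hlen.le)
  refine ⟨fun hx ↦ le_of_forall_gt_imp_ge_of_dense fun r hr ↦ ?_,
    fun hx ↦ le_of_forall_gt_imp_ge_of_dense fun r hr ↦ ?_⟩
  · rcases key hr with h1 | h1
    · exact h1.2
    · refine (ENNReal.ofReal_le_ofReal ?_).trans h1
      exact hfanti.antitoneOn (h.pos p hp).le (le_max hmax hx) (h.pos x hx).le
  · exact (key hr).resolve_left fun h1 ↦ hx h1.1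

theorem edist_le_ofReal_profile (h : IsHessianSolution (E := E) a k Ω u) (hp : p ∈ Ω)
    (hmax : IsMaxOn u (closure Ω) p) {f : ℝ → ℝ} (hfc : Continuous f) (hf0 : f (u p) = 0)
    (hfanti : StrictAntiOn f (Iic (u p)))
    (hf : ∀ s ∈ Ioo 0 (u p), 0 < (u p - s) * (2 * a + k * (s + u p)) ∧
      HasDerivAt f (-(1 / √((u p - s) * (2 * a + k * (s + u p))))) s) (hx : x ∈ Ω) :
    ∃ q ∈ Ω, u q = u p ∧ edist x q ≤ ENNReal.ofReal (f (u x)) := by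
  have hinj {y : M} (hy : y ∈ Ω) (hfy : f (u y) = 0) : u y = u p :=
    hfanti.injOn (le_max hmax hy) self_mem_Iic (hfy.trans hf0.symm)
  have hdesc : ∀ y ∈ {y | y ∈ Ω ∧ u x ≤ u y}, f (u y) ≠ 0 → ∀ c : ℝ, 0 < c → c < 1 →
      ∃ z ∈ {y | y ∈ Ω ∧ u x ≤ u y}, ∃ δ : ℝ, 0 ≤ δ ∧ edist y z ≤ ENNReal.ofReal δ ∧
        f (u z) + c * δ < f (u y) := by
    intro y hy hne c hc hc1
    have hyp : u y < u p := (le_max hmax hy.1).lt_of_ne fun he ↦ hne (by simp only [he, hf0])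
    obtain ⟨hg, hd, hd'⟩ := h.mvfderiv_profile_comp hp hmax hf hy.1 hyp
    -- In the direction `∇u` the function `f ∘ u` decreases at unit rate, which beats every `c < 1`.
    obtain ⟨z, hz, δ, hδ, hzd, hlt⟩ := exists_add_mul_riemannianEDist_lt hd
      (v := gradient 𝓘(ℝ, E) u y) (c := c) (by
        rw [hd', real_inner_self_eq_norm_mul_norm, mul_div_cancel_right₀ _ hg.ne']
        nlinarith) (h.isOpen.mem_nhds hy.1)
    refine ⟨z, ⟨hz, hy.2.trans ?_⟩, δ, hδ, ?_, hlt⟩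
    -- Descending in `f ∘ u` means climbing in `u`, so the new point stays in the compact superlevel
    -- set.
    · have h1 : f (u z) < f (u y) := by
        have := mul_nonneg hc.le hδ
        linarith
      exact ((hfanti.lt_iff_gt (le_max hmax hz) hyp.le).1 h1).le
    · rwa [IsRiemannianManifold.out (I := 𝓘(ℝ, E))]
  obtain ⟨q, hq, hq0, hle⟩ := exists_edist_le_of_descent (h.isCompact_superlevel (h.pos x hx))
    (φ := fun y ↦ f (u y))
    (hfc.comp_continuousOn (h.continuousOn.mono fun y hy ↦ subset_closure hy.1))
    (fun y hy ↦ hf0 ▸ hfanti.antitoneOn (le_max hmax hy.1) self_mem_Iic (le_max hmax hy.1))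
    hdesc (x := x) ⟨hx, le_rfl⟩
  exact ⟨q, hq.1, hinj hq.1 hq0, hle⟩

theorem exists_eball_of_ne_zero (h : IsHessianSolution (E := E) a k Ω u) (ha : 0 < a) (hp : p ∈ Ω)
    (hmax : IsMaxOn u (closure Ω) p) (hk : 0 < a + k * u p) :
    ∃ ρ : ℝ, 0 < ρ ∧ Ω = Metric.eball p (ENNReal.ofReal ρ) ∧
      ∃ f : ℝ → ℝ, ∀ x ∈ closure Ω, u x = f (edist p x).toReal := by
  obtain ⟨f, hfc, hf0, hfanti, hf⟩ := exists_profile (h.pos p hp) ha hk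
  have hf' := fun s hs ↦ And.intro (hf s hs).1 (hf s hs).2.2
  have hfnn {y : M} (hy : u y ≤ u p) : 0 ≤ f (u y) :=
    hf0 ▸ hfanti.antitoneOn hy self_mem_Iic hy
  have hreg : ∀ y ∈ Ω, u y < u p → mvfderiv 𝓘(ℝ, E) u y ≠ 0 := by
    intro y hy hyp h0
    have := (h.mvfderiv_profile_comp hp hmax hf' hy hyp).1
    simp [gradient, h0] at this
  have hedist {x : M} (hx : x ∈ Ω) : edist p x = ENNReal.ofReal (f (u x)) := by
    refine le_antisymm ?_ ((h.ofReal_profile_le_edist hp hmax hfc hf0 hfanti hf x).1 hx)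
    obtain ⟨q, hq, hqp, hle⟩ := h.edist_le_ofReal_profile hp hmax hfc hf0 hfanti hf' hx
    rw [h.eq_of_eq_max hp hmax hk.ne' hreg hq hqp, edist_comm]
    exact hle
  have hρ : 0 < f 0 := hf0 ▸ hfanti (h.pos p hp).le self_mem_Iic (h.pos p hp)
  refine ⟨f 0, hρ, ?_, ?_⟩
  · ext x
    rw [Metric.mem_eball']
    refine ⟨fun hx ↦ ?_, fun hx ↦ by_contra fun hxΩ ↦ ?_⟩
    · rw [hedist hx, ENNReal.ofReal_lt_ofReal_iff hρ]
      exact hfanti (h.pos p hp).le (le_max hmax hx) (h.pos x hx)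
    · exact ((h.ofReal_profile_le_edist hp hmax hfc hf0 hfanti hf x).2 hxΩ).not_gt hx
  · have hcl : ∀ x ∈ closure Ω, edist p x = ENNReal.ofReal (f (u x)) := by
      intro x hx
      have hne := mem_closure_iff_nhdsWithin_neBot.1 hx
      have h1 : Tendsto (fun y ↦ edist p y) (𝓝[Ω] x) (𝓝 (edist p x)) :=
        ((continuous_const.edist continuous_id : Continuous fun y ↦ edist p y).tendsto x).mono_left
          nhdsWithin_le_nhds
      have h2 : Tendsto (fun y ↦ ENNReal.ofReal (f (u y))) (𝓝[Ω] x)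
          (𝓝 (ENNReal.ofReal (f (u x)))) :=
        ENNReal.tendsto_ofReal ((hfc.tendsto _).comp ((h.continuousOn x hx).mono_left
          (nhdsWithin_mono _ subset_closure)))
      refine tendsto_nhds_unique h1 (h2.congr' ?_)
      filter_upwards [self_mem_nhdsWithin] with y hy using (hedist hy).symm
    -- The profile is injective below the maximum, so `u` is recovered from the distance.
    refine ⟨Function.invFunOn f (Iic (u p)), fun x hx ↦ ?_⟩
    rw [hcl x hx, ENNReal.toReal_ofReal (hfnn (hmax hx))]
    exact (hfanti.injOn.leftInvOn_invFunOn (hmax hx)).symm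

theorem exists_eball [Nontrivial E] (h : IsHessianSolution (E := E) a k Ω u) (ha : 0 < a)
    (hp : p ∈ Ω) (hmax : IsMaxOn u (closure Ω) p) :
    ∃ ρ : ℝ, 0 < ρ ∧ Ω = Metric.eball p (ENNReal.ofReal ρ) ∧
      ∃ f : ℝ → ℝ, ∀ x ∈ closure Ω, u x = f (edist p x).toReal := by
  rcases (h.add_mul_max_nonneg hp hmax).eq_or_lt' with hzero | hpos
  · have hΩ (x) (hx : x ∈ Ω) : u x = u p := h.eq_max_of_add_mul_max_eq_zero ha.le hp hmax hzero hx
    have hcl (x) (hx : x ∈ closure Ω) : u x = u p := by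
      have hne := mem_closure_iff_nhdsWithin_neBot.1 hx
      refine tendsto_nhds_unique ((h.continuousOn x hx).mono_left
        (nhdsWithin_mono _ subset_closure)) (tendsto_const_nhds.congr' ?_)
      filter_upwards [self_mem_nhdsWithin] with y hy using (hΩ y hy).symm
    have hfr : frontier Ω = ∅ := by
      refine eq_empty_of_forall_notMem fun x hx ↦ ?_
      have := hcl x (frontier_subset_closure hx)
      rw [h.eq_zero x hx] at this
      exact (h.pos p hp).ne this
    obtain ⟨ρ, hρ, hball⟩ := h.exists_eball_of_frontier_eq_empty hp hfr
    exact ⟨ρ, hρ, hball, fun _ ↦ u p, hcl⟩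
  · exact h.exists_eball_of_ne_zero ha hp hmax hpos

end IsHessianSolution

end RiemannianGeometry

theorem lemma2p2 {n : ℕ} (hn : 1 ≤ n)
    {M : Type*} [EMetricSpace M] [ChartedSpace (EuclideanSpace ℝ (Fin n)) M]
    [IsManifold (𝓡 n) ∞ M]
    [RiemannianBundle (fun x : M ↦ TangentSpace (𝓡 n) x)]
    [IsContMDiffRiemannianBundle (𝓡 n) ∞ (EuclideanSpace ℝ (Fin n))
      (fun x : M ↦ TangentSpace (𝓡 n) x)]
    [IsRiemannianManifold (𝓡 n) M]
    {Ω : Set M} (hopen : IsOpen Ω) (hconn : IsConnected Ω) (hcpt : IsCompact (closure Ω))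
    (k : ℝ) {u : M → ℝ} (hu0 : ContinuousOn u (closure Ω))
    (hu2 : ContMDiffOn (𝓡 n) 𝓘(ℝ) 2 u Ω)
    (hhess : ∀ x ∈ Ω, ∀ v w : TangentSpace (𝓡 n) x,
      RiemannianGeometry.hessian (𝓡 n) u x v w = -(1 / (n : ℝ) + k * u x) * inner ℝ v w)
    (hpos : ∀ x ∈ Ω, 0 < u x) (hbdry : ∀ x ∈ frontier Ω, u x = 0) :
    (∃ p ∈ Ω, IsMaxOn u (closure Ω) p) ∧
      ∀ p ∈ Ω, IsMaxOn u (closure Ω) p →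
        ∃ ρ : ℝ, 0 < ρ ∧ Ω = Metric.eball p (ENNReal.ofReal ρ) ∧
          ∃ f : ℝ → ℝ, ∀ x ∈ closure Ω, u x = f (edist p x).toReal := by
  -- For `n ≥ 1` the model space has a nonzero vector on which `add_mul_max_nonneg` tests the
  -- Hessian.
  have : Nonempty (Fin n) := ⟨⟨0, hn⟩⟩
  have h : RiemannianGeometry.IsHessianSolution (E := EuclideanSpace ℝ (Fin n)) (1 / (n : ℝ)) k Ω u :=
    ⟨hopen, hconn.isPreconnected, hcpt, hu0, hu2, hhess, hpos, hbdry⟩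
  have ha : 0 < 1 / (n : ℝ) := by positivity
  exact ⟨h.exists_isMaxOn hconn.nonempty, fun p hp hmax ↦ h.exists_eball ha hp hmax⟩
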